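/- A Jordan curve in $\mathbb{C}$ is the image of the unit circle under a continuous injective map into $\mathbb{C}$. For a Jordan curve $\Gamma\subset\mathbb{C}$, let $\Omega$ and $\Omega^*$ be the bounded and the unbounded (i.e. containing $\infty$) components of the complement of $\Gamma$ in the Riemann sphere $\widehat{\mathbb{C}}$. Let $A(\Omega)$ be the set of continuous functions $\overline{\Omega}\to\mathbb{C}$ that are analytic in $\Omega$, and let $A(\Omega^*)$ be the set of continuous functions $\overline{\Omega^*}\to\mathbb{C}$ that are analytic in $\Omega^*$ and vanish at $\infty$ (closures in $\widehat{\mathbb{C}}$). The curve $\Gamma$ is called MP-solvable if there exist non-constant functions $f\in A(\Omega)$ and $g\in A(\Omega^*)$ such that $f=\overline{g}$ on $\Gamma$. Corollary. For any Jordan curve $\Gamma\subset\mathbb{C}$ and every $\epsilon>0$, there exist an MP-solvable Jordan curve $\Gamma'\subset\mathbb{C}$ and a Jordan curve $\Gamma''\subset\mathbb{C}$ that is not MP-solvable such that $$\operatorname{dist}_H(\Gamma,\Gamma')<\epsilon,\qquad \operatorname{dist}_H(\Gamma,\Gamma'')<\epsilon,$$ where $\operatorname{dist}_H$ denotes the Hausdorff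 distance. -/

import Mathlib

noncomputable section

namespace MatchingProblem

open scoped OnePoint

/-- A Jordan curve in the complex plane: a homeomorphic (i.e. continuous injective) image
of the unit circle. -/
def IsJordanCurve (Γ : Set ℂ) : Prop :=
  ∃ γ : Circle → ℂ, Continuous γ ∧ Function.Injective γ ∧ Set.range γ = Γ

/-- The bounded part of the complement of `Γ`: the points off `Γ` whose connected component
in the complement is bounded. For a Jordan curve this is the bounded complementary
component `Ω`. -/
def inner (Γ : Set ℂ) : Set ℂ :=
  {z | z ∉ Γ ∧ Bornology.IsBounded (connectedComponentIn Γᶜ z)}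

/-- The unbounded complementary component `Ω*` of a bounded set `Γ`, as a subset of the Riemann
sphere `OnePoint ℂ`: the point at infinity together with the points off `Γ` whose connected
component in the complement is unbounded. -/
def outer (Γ : Set ℂ) : Set (OnePoint ℂ) :=
  insert ∞ ((fun z : ℂ => (z : OnePoint ℂ)) ''
    {z | z ∉ Γ ∧ ¬ Bornology.IsBounded (connectedComponentIn Γᶜ z)})

/-- The coordinate `w ↦ 1 / w` of the Riemann sphere around the point at infinity. -/
def invChart (w : ℂ) : OnePoint ℂ := if w = 0 then ∞ else ((w⁻¹ : ℂ) : OnePoint ℂ)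

/-- `g` is holomorphic on the open subset `U` of the Riemann sphere, tested in the two standard
coordinates `z` and `1 / z`. -/
def SphereHolomorphicOn (g : OnePoint ℂ → ℂ) (U : Set (OnePoint ℂ)) : Prop :=
  DifferentiableOn ℂ (fun z : ℂ => g z) {z : ℂ | (z : OnePoint ℂ) ∈ U} ∧
  DifferentiableOn ℂ (fun w : ℂ => g (invChart w)) {w : ℂ | invChart w ∈ U}

/-- `f ∈ A(Ω)`: continuous on the closure of `Ω` and analytic in `Ω`. -/
def MemAInner (Γ : Set ℂ) (f : ℂ → ℂ) : Prop :=
  ContinuousOn f (closure (inner Γ)) ∧ DifferentiableOn ℂ f (inner Γ)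

/-- `g ∈ A(Ω*)`: continuous on the closure of `Ω*` in the Riemann sphere, analytic in `Ω*`
(including at infinity), and vanishing at infinity. -/
def MemAOuter (Γ : Set ℂ) (g : OnePoint ℂ → ℂ) : Prop :=
  ContinuousOn g (closure (outer Γ)) ∧ SphereHolomorphicOn g (outer Γ) ∧ g ∞ = 0

/-- `h` is not constant on `S`. -/
def NonconstantOn {X Y : Type*} (h : X → Y) (S : Set X) : Prop :=
  ∃ x ∈ S, ∃ y ∈ S, h x ≠ h y

/-- The curve `Γ` is MP-solvable: there are non-constant `f ∈ A(Ω)` and `g ∈ A(Ω*)` that are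
complex conjugate to each other on `Γ`. -/
def IsMPSolvable (Γ : Set ℂ) : Prop :=
  ∃ (f : ℂ → ℂ) (g : OnePoint ℂ → ℂ),
    MemAInner Γ f ∧ NonconstantOn f (closure (inner Γ)) ∧
    MemAOuter Γ g ∧ NonconstantOn g (closure (outer Γ)) ∧
    ∀ z ∈ Γ, f z = (starRingEnd ℂ) (g (z : OnePoint ℂ))

end MatchingProblem

end

/-! ### Plane arcs: connected complement and empty interior -/

namespace MatchingProblem

open Set Metric Filter Topology Complex

/-! Removing a short open piece of `Γ` leaves an arc `K` that is Hausdorff-close to `Γ`. An arc has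
connected complement and empty interior, so Hilbert's lemniscate theorem applies: some `q(z) = ∏ ‖z
- w i‖` with nodes in `K` is at most `M₁` on `K` and exceeds `M₁` at every point at distance at
least `δ` from `K`. For `M` slightly above `M₁`, the function `(∏ (z - w i))^(-1/n)` maps the
exterior `{q > M}`, with `∞` going to `0`, conformally onto a disc of radius `r₀`; its inverse is
`ψ`. Every Jordan curve in that disc that winds sufficiently close to the boundary circle is carried
by `ψ` to a Jordan curve close to `K`. Both required curves arise in this way, and their
complementary components are read off from the coordinate, so the Jordan curve theorem is not
needed.

Solvable curve: the image of a circle of radius `r` is a lemniscate. On it `f = r^n ∏ (z - w i)` has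
modulus `1`, so `conj f = 1 / f`, and `g = 1 / f` is holomorphic outside and vanishes at `∞`.

Non-solvable curve: replace the circle by one which, in a half-plane coordinate sending one of its
points to `∞`, is the real line far to the left and the line of height `s` far to the right. A
matching pair `f`, `g` gives two holomorphic functions `F` below and `G` above. Uniqueness at either
end forces `F` to be the Schwarz reflection of `G` in each of the two lines, so `G` is invariant
under the translation by `2 s i`. Iterating the translation leads to the point `∞` of the curve,
where `g` is continuous; hence `G` is constant, and so is `g` by the identity theorem.

The two main supports are `exists_exteriorCoordinate_close` (approximation) and
`eq_add_period_of_kink_match` (rigidity). -/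

theorem exists_continuousMap_exp_eq {A : Type*} [TopologicalSpace A] [SimplyConnectedSpace A]
    [LocallyPathConnectedSpace A] (f : C(A, ℂ)) (hf : ∀ a, f a ≠ 0) :
    ∃ L : C(A, ℂ), ∀ a, exp (L a) = f a := by
  obtain ⟨a₀⟩ : Nonempty A := inferInstance
  obtain ⟨F, ⟨-, hF⟩, -⟩ := isCoveringMapOn_exp.existsUnique_continuousMap_lifts f
    (a₀ := a₀) (e₀ := log (f a₀)) (exp_log (hf a₀)) hf
  exact ⟨F, fun a => congrFun hF a⟩

/-- Subtracting `i t` from the logarithm along the circle leaves a continuous function with constant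
exponential. It takes values in a discrete set, so it is constant, yet it must drop by `2 π i` over
one turn. -/
theorem not_exists_continuous_log_circle {G : ℂ → ℂ} (hG : Continuous G) {c : ℂ} {R : ℝ}
    (hR : 0 < R) (h : ∀ z, ‖z - c‖ = R → exp (G z) = z - c) : False := by
  have hcm : ∀ t : ℝ, exp (G (circleMap c R t) - t * I) = R := by
    intro t
    rw [exp_sub, h _ (by simp [circleMap, abs_of_pos hR])]
    simp [circleMap]
  set H : ℝ → ℂ := fun t => G (circleMap c R t) - t * I with hH
  have hHc : Continuous H := by fun_prop
  have hconst : ∀ t, ∃ n : ℤ, H t = H 0 + n * (2 * Real.pi * I) := fun t =>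
    exp_eq_exp_iff_exists_int.1 ((hcm t).trans (hcm 0).symm)
  choose n hn using hconst
  have hn' : ∀ t, (n t : ℝ) = (H t - H 0).im / (2 * Real.pi) := by
    intro t
    rw [hn t]
    simp
  have hnc : Continuous n := by
    have : Continuous fun t => (n t : ℝ) := by
      simp_rw [hn']
      fun_prop
    exact Int.isClosedEmbedding_coe_real.isEmbedding.continuous_iff.2 this
  have h1 : n 0 = n (2 * Real.pi) := PreconnectedSpace.constant inferInstance hnc
  have h2 := hn' 0
  have h3 := hn' (2 * Real.pi)
  rw [← h1, h2] at h3
  have : circleMap c R (2 * Real.pi) = circleMap c R 0 := by simp [circleMap]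
  simp [hH, this] at h3

/-- Borsuk's argument. On the arc `z - c` has a logarithm, which Tietze extends to the plane. If the
component of `c` were bounded, replacing `z - c` there by the exponential of this extension would
remove its only zero, and the resulting global logarithm would restrict to one of `z - c` on a large
circle. -/
theorem not_isBounded_connectedComponentIn_compl_arc (σ : C(unitInterval, ℂ))
    (hσ : Function.Injective σ) {c : ℂ} (hc : c ∉ range σ) :
    ¬ Bornology.IsBounded (connectedComponentIn (range σ)ᶜ c) := by
  intro hb
  set B := connectedComponentIn (range σ)ᶜ c with hB
  have hK : IsClosed (range σ) := (isCompact_range σ.continuous).isClosed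
  have hBo : IsOpen B := hK.isOpen_compl.connectedComponentIn
  -- The path is extended by constants to all of `ℝ`, and the lift is taken there before restricting
  -- to the interval.
  obtain ⟨L', hL'⟩ := exists_continuousMap_exp_eq
    (⟨fun t : ℝ => σ (projIcc 0 1 zero_le_one t) - c, by fun_prop⟩ : C(ℝ, ℂ))
    (fun t => by simpa [sub_eq_zero] using fun h => hc ⟨_, h⟩)
  obtain ⟨L, hL⟩ : ∃ L : C(unitInterval, ℂ), ∀ t, exp (L t) = σ t - c :=
    ⟨⟨fun t => L' t, by fun_prop⟩, fun t => by simpa using hL' t⟩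
  have hce : IsClosedEmbedding σ := σ.continuous.isClosedEmbedding hσ
  obtain ⟨E, hE⟩ := ContinuousMap.exists_extension hce L
  have hEK : ∀ z ∈ range σ, exp (E z) = z - c := by
    rintro _ ⟨t, rfl⟩
    rw [← hL t, ← hE]
    rfl
  have hfr : ∀ z ∈ frontier B, z ∈ range σ := by
    intro z hz
    by_contra hzK
    have hzB : z ∈ closure B := frontier_subset_closure hz
    have : z ∈ B := by
      obtain ⟨y, hy1, hy2⟩ := mem_closure_iff.1 hzB _
        (hK.isOpen_compl.connectedComponentIn (x := z)) (mem_connectedComponentIn hzK)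
      rw [hB, connectedComponentIn_eq hy2, ← connectedComponentIn_eq hy1]
      exact mem_connectedComponentIn hzK
    rw [hBo.frontier_eq] at hz
    exact hz.2 this
  classical
  -- The two formulas agree on the frontier of `B`, which lies on the arc.
  have hcont : Continuous (fun z => if z ∈ B then exp (E z) else z - c) := by
    refine Continuous.if (fun z hz => hEK z (hfr z hz)) (by fun_prop) (by fun_prop)
  obtain ⟨G, hG⟩ := exists_continuousMap_exp_eq ⟨_, hcont⟩ (fun z => by
    by_cases hz : z ∈ B
    · simp [hz, exp_ne_zero]
    · have : z ≠ c := fun h => hz (h ▸ mem_connectedComponentIn hc)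
      simp [hz, sub_eq_zero, this])
  obtain ⟨R, hR⟩ := hb.subset_closedBall c
  refine not_exists_continuous_log_circle (c := c) (R := |R| + 1) G.continuous (by positivity) ?_
  intro z hz
  have hzB : z ∉ B := fun h => by
    have := hR h
    rw [mem_closedBall, dist_eq_norm, hz] at this
    linarith [le_abs_self R]
  simpa [hzB] using hG z

theorem isPreconnected_compl_closedBall_zero {R : ℝ} (hR : 0 ≤ R) :
    IsPreconnected (closedBall (0 : ℂ) R)ᶜ := by
  have : (closedBall (0 : ℂ) R)ᶜ = (fun p : ℝ × ℝ => circleMap 0 p.1 p.2) '' (Ioi R ×ˢ univ) := by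
    ext z
    simp only [mem_compl_iff, mem_closedBall, dist_zero_right, not_le, mem_image, mem_prod, mem_Ioi,
      mem_univ, and_true, Prod.exists]
    constructor
    · intro hz
      exact ⟨‖z‖, z.arg, hz, by simp [circleMap, norm_mul_exp_arg_mul_I]⟩
    · rintro ⟨r, θ, hr, rfl⟩
      simpa [circleMap, abs_of_pos (hR.trans_lt hr)] using hr
  rw [this]
  refine (isPreconnected_Ioi.prod isPreconnected_univ).image _ ?_
  unfold circleMap
  fun_prop

theorem isPreconnected_compl_arc (σ : C(unitInterval, ℂ)) (hσ : Function.Injective σ) :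
    IsPreconnected (range σ)ᶜ := by
  obtain ⟨R, hR0, hR⟩ := (isCompact_range σ.continuous).isBounded.subset_closedBall_lt 0 0
  have hconn := isPreconnected_compl_closedBall_zero hR0.le
  have hsub : (closedBall (0 : ℂ) R)ᶜ ⊆ (range σ)ᶜ := compl_subset_compl.2 hR
  refine isPreconnected_of_forall_pair fun x hx y hy => ?_
  have key : ∀ x ∉ range σ, ∃ p ∈ (closedBall (0 : ℂ) R)ᶜ,
      p ∈ connectedComponentIn (range σ)ᶜ x := by
    intro x hx
    by_contra! h
    exact not_isBounded_connectedComponentIn_compl_arc σ hσ hx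
      (isBounded_closedBall.subset fun p hp => by_contra fun hp' => h p hp' hp)
  obtain ⟨p, hp, hpx⟩ := key x hx
  obtain ⟨p', hp', hpy⟩ := key y hy
  refine ⟨connectedComponentIn (range σ)ᶜ x, connectedComponentIn_subset _ _,
    mem_connectedComponentIn hx, ?_, isPreconnected_connectedComponentIn⟩
  have h1 : p' ∈ connectedComponentIn (range σ)ᶜ p :=
    hconn.subset_connectedComponentIn hp hsub hp'
  rw [connectedComponentIn_eq hpx, connectedComponentIn_eq h1, ← connectedComponentIn_eq hpy]
  exact mem_connectedComponentIn hy

/-- Otherwise a circle in the interior would be parametrised injectively by points of an interval.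
The difference of the parameters of antipodal points is odd under a half turn, so it vanishes
somewhere: Borsuk–Ulam in dimension one. -/
theorem interior_range_arc_eq_empty (σ : C(unitInterval, ℂ)) (hσ : Function.Injective σ) :
    interior (range σ) = ∅ := by
  by_contra hne
  obtain ⟨c, hc⟩ := nonempty_iff_ne_empty.2 hne
  obtain ⟨r, hr, hball⟩ := Metric.isOpen_iff.1 isOpen_interior c hc
  have hemb : IsEmbedding σ := (σ.continuous.isClosedEmbedding hσ).isEmbedding
  have hcr : ∀ θ : ℝ, circleMap c (r / 2) θ ∈ range σ := fun θ =>
    interior_subset (hball (by simp [circleMap, abs_of_pos hr]; linarith))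
  choose τ hτ using hcr
  have hτc : Continuous τ := by
    rw [hemb.continuous_iff]
    refine (continuous_circleMap c (r / 2)).congr fun θ => (hτ θ).symm
  have hper : τ (0 + Real.pi + Real.pi) = τ 0 := hσ (by
    rw [hτ, hτ]
    simp [circleMap, add_mul, exp_add])
  set h : ℝ → ℝ := fun θ => (τ (θ + Real.pi) : ℝ) - τ θ with hh
  have hhc : Continuous h := by fun_prop
  have hsum : h Real.pi = - h 0 := by
    simp only [hh]
    rw [zero_add] at hper ⊢
    rw [hper]
    ring
  obtain ⟨θ, hθ⟩ : ∃ θ, h θ = 0 := by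
    rcases le_total (h 0) 0 with h0 | h0
    · exact mem_range_of_exists_le_of_exists_ge hhc ⟨0, h0⟩ ⟨Real.pi, by linarith⟩
    · exact mem_range_of_exists_le_of_exists_ge hhc ⟨Real.pi, by linarith⟩ ⟨0, h0⟩
  have heq : τ (θ + Real.pi) = τ θ := Subtype.ext (sub_eq_zero.1 hθ)
  have h1 := hτ θ
  rw [← heq, hτ] at h1
  simp [circleMap, add_mul, exp_add, hr.ne', neg_eq_iff_add_eq_zero] at h1

end MatchingProblem

/-! ### Harnack's inequality and Fekete polynomials -/

namespace MatchingProblem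

open Set Metric Filter Topology Complex

/-- At distance `d ≤ R / 2` from the centre the Poisson kernel is at least `(R - d) / (R + d) ≥ 1 /
3`. -/
theorem harnack_third {f : ℂ → ℝ} {c w : ℂ} {R : ℝ} (hR : 0 < R)
    (hf : InnerProductSpace.HarmonicOnNhd f (closedBall c R)) (h0 : ∀ z ∈ closedBall c R, 0 ≤ f z)
    (hw : dist w c ≤ R / 2) : f c / 3 ≤ f w := by
  have hwb : w ∈ ball c R := by rw [mem_ball]; linarith
  have hwc : ‖w - c‖ ≤ R / 2 := by rwa [← dist_eq_norm]
  have hfc : ContinuousOn f (closedBall c R) := fun z hz => (hf z hz).1.continuousAt.continuousWithinAt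
  have habs : |R| = R := abs_of_pos hR
  rw [← hf.circleAverage_re_herglotzRieszKernel_smul hwb,
    ← InnerProductSpace.HarmonicOnNhd.circleAverage_eq (by rwa [habs] : InnerProductSpace.HarmonicOnNhd f (closedBall c |R|)),
    div_eq_inv_mul, ← smul_eq_mul, ← Real.circleAverage_smul]
  have hfs : ContinuousOn f (sphere c R) := hfc.mono sphere_subset_closedBall
  apply Real.circleAverage_mono
  · refine ContinuousOn.circleIntegrable hR.le ?_
    exact hfs.const_smul _
  · refine ContinuousOn.circleIntegrable hR.le ?_
    refine ContinuousOn.smul (continuous_re.comp_continuousOn ?_) hfs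
    rw [herglotzRieszKernel_fun_def]
    refine ContinuousOn.div (by fun_prop) (by fun_prop) fun z hz h => ?_
    have hz' : ‖z - c‖ = R := by simpa [dist_eq_norm] using hz
    rw [sub_eq_zero.1 h] at hz'
    linarith
  · rw [habs]
    intro z hz
    have hk := le_re_herglotzRieszKernel hz hwb
    have : (3 : ℝ)⁻¹ ≤ (R - ‖w - c‖) / (R + ‖w - c‖) := by
      rw [inv_eq_one_div, div_le_div_iff₀ (by norm_num) (by positivity)]
      linarith
    exact mul_le_mul_of_nonneg_right (this.trans hk) (h0 z (sphere_subset_closedBall hz))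

/-- Isolates the dependence of the discriminant product on the single point `v j`, so that
maximality can be tested by moving that point alone. -/
theorem prod_offDiag_eq {n : ℕ} (v : Fin n → ℂ) (j : Fin n) :
    ∏ i, ∏ k ∈ Finset.univ.erase i, ‖v i - v k‖ =
      (∏ k ∈ Finset.univ.erase j, ‖v j - v k‖) ^ 2 *
        ∏ i ∈ Finset.univ.erase j, ∏ k ∈ (Finset.univ.erase j).erase i, ‖v i - v k‖ := by
  rw [← Finset.mul_prod_erase _ _ (Finset.mem_univ j), pow_two, mul_assoc]
  congr 1
  have : ∀ i ∈ Finset.univ.erase j, ∏ k ∈ Finset.univ.erase i, ‖v i - v k‖ =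
      ‖v j - v i‖ * ∏ k ∈ (Finset.univ.erase j).erase i, ‖v i - v k‖ := by
    intro i hi
    rw [← Finset.mul_prod_erase _ _ (Finset.mem_erase.2 ⟨(Finset.ne_of_mem_erase hi).symm, Finset.mem_univ j⟩),
      Finset.erase_right_comm, norm_sub_rev]
  rw [Finset.prod_congr rfl this, Finset.prod_mul_distrib]

/-- Fekete points of an infinite compact set. -/
theorem exists_fekete {K : Set ℂ} (hK : IsCompact K) (hinf : K.Infinite) (n : ℕ) :
    ∃ v : Fin n → ℂ, (∀ i, v i ∈ K) ∧ Function.Injective v ∧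
      ∀ j, ∀ z ∈ K, ∏ i ∈ Finset.univ.erase j, ‖z - v i‖ ≤
        ∏ i ∈ Finset.univ.erase j, ‖v j - v i‖ := by
  set D : (Fin n → ℂ) → ℝ := fun v => ∏ i, ∏ k ∈ Finset.univ.erase i, ‖v i - v k‖ with hD
  have hDc : Continuous D := by fun_prop
  obtain ⟨e⟩ : Nonempty (ℕ ↪ K) := ⟨hinf.natEmbedding⟩
  have hcomp : IsCompact (univ.pi fun _ : Fin n => K) := isCompact_univ_pi fun _ => hK
  have hmem : (fun i : Fin n => (e i : ℂ)) ∈ univ.pi fun _ : Fin n => K := fun i _ => (e i).2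
  obtain ⟨v, hv, hmax⟩ := hcomp.exists_isMaxOn ⟨_, hmem⟩ hDc.continuousOn
  have hpos : ∀ v : Fin n → ℂ, Function.Injective v → 0 < D v := fun v hv =>
    Finset.prod_pos fun i _ => Finset.prod_pos fun k hk =>
      norm_pos_iff.2 (sub_ne_zero.2 fun h => (Finset.ne_of_mem_erase hk) (hv h).symm)
  have hDv : 0 < D v := (hpos _ fun i j h => by
    simpa [Fin.ext_iff] using e.injective (Subtype.ext h)).trans_le (hmax hmem)
  have hinj : Function.Injective v := by
    intro i k h
    by_contra hne
    refine hDv.ne' (Finset.prod_eq_zero (Finset.mem_univ i)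
      (Finset.prod_eq_zero (Finset.mem_erase.2 ⟨Ne.symm hne, Finset.mem_univ k⟩) ?_))
    rw [h, sub_self, norm_zero]
  refine ⟨v, fun i => hv i (mem_univ i), hinj, fun j z hz => ?_⟩
  have hup : Function.update v j z ∈ univ.pi fun _ : Fin n => K := by
    intro i _
    by_cases hij : i = j
    · subst hij; simpa using hz
    · simpa [hij] using hv i (mem_univ i)
  have h1 : D (Function.update v j z) ≤ D v := hmax hup
  have hDv' := hDv
  simp only [hD] at h1 hDv'
  rw [prod_offDiag_eq _ j, prod_offDiag_eq v j] at h1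
  rw [prod_offDiag_eq v j] at hDv'
  have e1 : ∏ k ∈ Finset.univ.erase j, ‖Function.update v j z j - Function.update v j z k‖ =
      ∏ k ∈ Finset.univ.erase j, ‖z - v k‖ :=
    Finset.prod_congr rfl fun k hk => by simp [Finset.ne_of_mem_erase hk]
  have e2 : ∏ i ∈ Finset.univ.erase j, ∏ k ∈ (Finset.univ.erase j).erase i,
      ‖Function.update v j z i - Function.update v j z k‖ =
      ∏ i ∈ Finset.univ.erase j, ∏ k ∈ (Finset.univ.erase j).erase i, ‖v i - v k‖ :=
    Finset.prod_congr rfl fun i hi => Finset.prod_congr rfl fun k hk => by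
      simp [Finset.ne_of_mem_erase hi, Finset.ne_of_mem_erase (Finset.mem_of_mem_erase hk)]
  rw [e1, e2] at h1
  have hrest : 0 < ∏ i ∈ Finset.univ.erase j, ∏ k ∈ (Finset.univ.erase j).erase i, ‖v i - v k‖ :=
    lt_of_le_of_ne (by positivity) fun h => by rw [← h] at hDv'; simp at hDv'
  exact (pow_le_pow_iff_left₀ (by positivity) (by positivity) two_ne_zero).1
    (le_of_mul_le_mul_right h1 hrest)

theorem prod_erase_eq_prod_succAbove {n : ℕ} (f : Fin (n + 1) → ℝ) (j : Fin (n + 1)) :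
    ∏ i ∈ Finset.univ.erase j, f i = ∏ i, f (j.succAbove i) := by
  rw [Fin.univ_succAbove n j, Finset.erase_cons, Finset.prod_map]
  rfl

/-- Take `n + 1` Fekete points and discard the one, `p`, whose product of distances to the others is
smallest. The upper bound on `K` is the Fekete property. The lower bound off `K` comes from the
Lagrange basis summing to `1`: each of its `n + 1` terms is controlled because the product at `p` is
the smallest denominator. -/
theorem exists_fekete_polynomial {K : Set ℂ} (hK : IsCompact K) (hinf : K.Infinite) (n : ℕ) :
    ∃ (w : Fin n → ℂ) (p : ℂ), p ∈ K ∧ (∀ i, w i ∈ K) ∧ 0 < ∏ i, ‖p - w i‖ ∧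
      (∀ z ∈ K, ∏ i, ‖z - w i‖ ≤ ∏ i, ‖p - w i‖) ∧
      ∀ z ∉ K, (∏ i, ‖p - w i‖) * infDist z K ≤ (n + 1) * (‖z - p‖ * ∏ i, ‖z - w i‖) := by
  obtain ⟨v, hvK, hinj, hv⟩ := exists_fekete hK hinf (n + 1)
  obtain ⟨j, hj⟩ := Finite.exists_min fun j => ∏ i ∈ Finset.univ.erase j, ‖v j - v i‖
  have hm : ∀ j, 0 < ∏ i ∈ Finset.univ.erase j, ‖v j - v i‖ := fun j =>
    Finset.prod_pos fun i hi => norm_pos_iff.2 (sub_ne_zero.2 fun h =>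
      (Finset.ne_of_mem_erase hi) (hinj h).symm)
  refine ⟨fun i => v (j.succAbove i), v j, hvK j, fun i => hvK _, ?_, ?_, ?_⟩
  · rw [← prod_erase_eq_prod_succAbove (fun i => ‖v j - v i‖)]
    exact hm j
  · intro z hz
    rw [← prod_erase_eq_prod_succAbove (fun i => ‖v j - v i‖),
      ← prod_erase_eq_prod_succAbove (fun i => ‖z - v i‖)]
    exact hv j z hz
  · intro z hz
    rw [← prod_erase_eq_prod_succAbove (fun i => ‖v j - v i‖),
      ← prod_erase_eq_prod_succAbove (fun i => ‖z - v i‖),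
      Finset.mul_prod_erase _ (fun i => ‖z - v i‖) (Finset.mem_univ j)]
    set m := ∏ i ∈ Finset.univ.erase j, ‖v j - v i‖ with hmdef
    set P := ∏ i, ‖z - v i‖ with hP
    have hd : 0 < infDist z K :=
      (hK.isClosed.notMem_iff_infDist_pos ⟨_, hvK j⟩).1 hz
    have hsum := congrArg (Polynomial.eval z) (Lagrange.sum_basis (s := Finset.univ) (v := v)
      hinj.injOn Finset.univ_nonempty)
    rw [Polynomial.eval_finsetSum, Polynomial.eval_one] at hsum
    have hb : ∀ k, ‖Polynomial.eval z (Lagrange.basis Finset.univ v k)‖ ≤ P / (infDist z K * m) := by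
      intro k
      have hk : ‖Polynomial.eval z (Lagrange.basis Finset.univ v k)‖ =
          (∏ i ∈ Finset.univ.erase k, ‖z - v i‖) / ∏ i ∈ Finset.univ.erase k, ‖v k - v i‖ := by
        rw [Lagrange.basis, Polynomial.eval_prod, norm_prod, ← Finset.prod_div_distrib]
        refine Finset.prod_congr rfl fun i _ => ?_
        simp [Lagrange.basisDivisor, div_eq_inv_mul]
      have hzk : infDist z K ≤ ‖z - v k‖ := by
        rw [← dist_eq_norm]; exact infDist_le_dist_of_mem (hvK k)
      rw [hk, hP, ← Finset.mul_prod_erase _ _ (Finset.mem_univ k),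
        div_le_div_iff₀ (hm k) (mul_pos hd (hm j))]
      have := mul_le_mul hzk (hj k) (hm j).le (norm_nonneg _)
      calc _ ≤ (∏ i ∈ Finset.univ.erase k, ‖z - v i‖) *
            (‖z - v k‖ * ∏ i ∈ Finset.univ.erase k, ‖v k - v i‖) := by gcongr
        _ = _ := by ring
    have h1 : (1 : ℝ) ≤ (n + 1) * (P / (infDist z K * m)) := by
      calc (1 : ℝ) = ‖∑ k, Polynomial.eval z (Lagrange.basis Finset.univ v k)‖ := by rw [hsum]; simp
        _ ≤ ∑ k, ‖Polynomial.eval z (Lagrange.basis Finset.univ v k)‖ := norm_sum_le _ _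
        _ ≤ ∑ k : Fin (n + 1), P / (infDist z K * m) := Finset.sum_le_sum fun k _ => hb k
        _ = _ := by simp
    rw [← mul_div_assoc, le_div_iff₀ (mul_pos hd (hm j))] at h1
    linarith

end MatchingProblem

/-! ### Hilbert's lemniscate theorem -/

namespace MatchingProblem

open Set Metric Filter Topology Complex

theorem harmonicOnNhd_log_norm_prod {n : ℕ} (w : Fin n → ℂ) (a : ℝ) {S : Set ℂ}
    (hS : ∀ i, w i ∉ S) :
    InnerProductSpace.HarmonicOnNhd (fun z => Real.log (∏ i, ‖z - w i‖) + a) S := by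
  intro z hz
  have h1 : AnalyticAt ℂ (fun z => ∏ i, (z - w i)) z := by fun_prop
  have h2 : (∏ i, (z - w i)) ≠ 0 :=
    Finset.prod_ne_zero_iff.2 fun i _ h => hS i ((sub_eq_zero.1 h) ▸ hz)
  have := (h1.harmonicAt_log_norm h2).add
    (InnerProductSpace.harmonicAt_const a : InnerProductSpace.HarmonicAt (fun _ : ℂ => a) z)
  simpa only [norm_prod, Pi.add_def] using this

/-- Let `u n` be the logarithm of the `n`-th Fekete polynomial's modulus divided by its bound on
`K`. Off `K` it is harmonic and locally at least `-O(log n)`, and far from `K` it is at least `n`.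
Harnack's inequality propagates linear growth through the connected complement, the logarithmic loss
being negligible. Compactness then yields one `n` with `u n > 0` wherever the distance to `K` is at
least `δ`. -/
theorem exists_norm_prod_gt_of_compl_preconnected {K : Set ℂ} (hK : IsCompact K)
    (hinf : K.Infinite) (hconn : IsPreconnected Kᶜ) {δ : ℝ} (hδ : 0 < δ) :
    ∃ (n : ℕ) (w : Fin n → ℂ) (M : ℝ), 0 < n ∧ (∀ i, w i ∈ K) ∧ 0 < M ∧
      (∀ z ∈ K, ∏ i, ‖z - w i‖ ≤ M) ∧ ∀ z, δ ≤ infDist z K → M < ∏ i, ‖z - w i‖ := by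
  choose w p hpK hwK hm hle hlow using exists_fekete_polynomial hK hinf
  have hne : K.Nonempty := hinf.nonempty
  set m : ℕ → ℝ := fun n => ∏ i, ‖p n - w n i‖ with hmdef
  set u : ℕ → ℂ → ℝ := fun n z => Real.log (∏ i, ‖z - w n i‖) + -Real.log (m n) with hu
  have hpos : ∀ z ∉ K, 0 < infDist z K := fun z hz => (hK.isClosed.notMem_iff_infDist_pos hne).1 hz
  have hprod : ∀ n, ∀ z ∉ K, 0 < ∏ i, ‖z - w n i‖ := fun n z hz =>
    Finset.prod_pos fun i _ => norm_pos_iff.2 (sub_ne_zero.2 fun h => hz (h ▸ hwK n i))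
  have hulow : ∀ n, ∀ z ∉ K, Real.log (infDist z K) - Real.log ‖z - p n‖ - Real.log (n + 1) ≤ u n z := by
    intro n z hz
    have hzp : 0 < ‖z - p n‖ := norm_pos_iff.2 (sub_ne_zero.2 fun h => hz (h ▸ hpK n))
    have := Real.log_le_log (mul_pos (hm n) (hpos z hz)) (hlow n z hz)
    rw [Real.log_mul (hm n).ne' (hpos z hz).ne', Real.log_mul (by positivity)
      (mul_pos hzp (hprod n z hz)).ne', Real.log_mul hzp.ne' (hprod n z hz).ne'] at this
    simp only [hu, hmdef]
    linarith
  obtain ⟨D, hD0, hD⟩ : ∃ D > 0, ∀ x ∈ K, ∀ y ∈ K, ‖x - y‖ ≤ D := by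
    obtain ⟨D, hD⟩ := (isBounded_iff.1 hK.isBounded)
    refine ⟨|D| + 1, by positivity, fun x hx y hy => ?_⟩
    rw [← dist_eq_norm]
    linarith [hD hx hy, le_abs_self D]
  -- At distance at least `3 * D` each factor is at least three times the corresponding factor at `p
  -- n`, and `log 3 ≥ 1`.
  have hfar : ∀ n z, 3 * D ≤ infDist z K → n ≤ u n z := by
    intro n z hz
    have hzK : z ∉ K := fun h => by
      rw [infDist_zero_of_mem h] at hz
      linarith
    have hlog3 : (1 : ℝ) ≤ Real.log 3 := by
      rw [Real.le_log_iff_exp_le (by norm_num)]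
      linarith [Real.exp_one_lt_d9]
    have h1 : 3 ^ n * m n ≤ ∏ i, ‖z - w n i‖ := by
      have : (3 : ℝ) ^ n * m n = ∏ i, (3 * ‖p n - w n i‖) := by
        rw [Finset.prod_mul_distrib]
        simp [hmdef]
      rw [this]
      refine Finset.prod_le_prod (fun i _ => by positivity) fun i _ => ?_
      calc 3 * ‖p n - w n i‖ ≤ 3 * D := by gcongr; exact hD _ (hpK n) _ (hwK n i)
        _ ≤ infDist z K := hz
        _ ≤ ‖z - w n i‖ := by rw [← dist_eq_norm]; exact infDist_le_dist_of_mem (hwK n i)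
    have h2 := Real.log_le_log (mul_pos (by positivity) (hm n)) h1
    rw [Real.log_mul (by positivity) (hm n).ne', Real.log_pow] at h2
    simp only [hu]
    have : (n : ℝ) * 1 ≤ n * Real.log 3 := by gcongr
    linarith
  -- The points near which `u n` grows at least linearly in `n`; this set is shown to be open and
  -- relatively closed in `Kᶜ`.
  set G : Set ℂ := {z | ∃ c > 0, ∃ r > 0, ∃ N : ℕ, ∀ n ≥ N, ∀ z' ∈ ball z r, c * n ≤ u n z'} with hG
  have hGo : IsOpen G := by
    rw [Metric.isOpen_iff]
    rintro z ⟨c, hc, r, hr, N, h⟩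
    refine ⟨r, hr, fun z1 hz1 => ⟨c, hc, r - dist z1 z, by simpa using hz1, N, fun n hn z' hz' =>
      h n hn z' ?_⟩⟩
    rw [mem_ball] at hz' ⊢
    linarith [dist_triangle z' z1 z]
  have hGne : (Kᶜ ∩ G).Nonempty := by
    obtain ⟨B, hB⟩ := hK.isBounded.subset_closedBall 0
    have hdist : ∀ z : ℂ, |B| + 3 * D + 1 ≤ ‖z‖ → 3 * D ≤ infDist z K := by
      intro z hz
      refine (le_infDist hne).2 fun y hy => ?_
      have h1 : ‖y‖ ≤ B := by simpa using hB hy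
      rw [dist_eq_norm]
      linarith [norm_sub_norm_le z y, le_abs_self B]
    refine ⟨((|B| + 3 * D + 2 : ℝ) : ℂ), ?_, 1, one_pos, 1, one_pos, 0, fun n _ z' hz' => ?_⟩
    · intro h
      have := hdist ((|B| + 3 * D + 2 : ℝ) : ℂ) (by rw [norm_real, Real.norm_of_nonneg (by positivity)]; linarith)
      rw [infDist_zero_of_mem h] at this
      linarith
    · rw [one_mul]
      refine hfar n z' (hdist z' ?_)
      rw [mem_ball, dist_comm, dist_eq_norm] at hz'
      have h1 := norm_sub_norm_le ((|B| + 3 * D + 2 : ℝ) : ℂ) z'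
      rw [norm_real, Real.norm_of_nonneg (by positivity)] at h1
      linarith
  have hsub : Kᶜ ⊆ G := by
    refine hconn.subset_of_closure_inter_subset hGo hGne ?_
    rintro z ⟨hzG, hzK⟩
    -- With `z1` within `r` of `z`, the disc of radius `4 r` about `z1` stays at distance `8 r - 5 r
    -- = 3 r` from `K`, and `ball z r` lies in the concentric disc of half that radius.
    set r := infDist z K / 8 with hr
    have hd : infDist z K = 8 * r := by rw [hr]; ring
    have hr0 : 0 < r := by have := hpos z hzK; linarith
    obtain ⟨z1, ⟨c, hc, r1, hr1, N, hN⟩, hz1⟩ := Metric.mem_closure_iff.1 hzG r hr0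
    obtain ⟨B, hB0, hB⟩ : ∃ B > 0, ∀ y ∈ K, ‖z - y‖ ≤ B := by
      obtain ⟨B, hB⟩ := hK.isBounded.subset_closedBall z
      refine ⟨|B| + 1, by positivity, fun y hy => ?_⟩
      have := hB hy
      rw [mem_closedBall, dist_comm, dist_eq_norm] at this
      linarith [le_abs_self B]
    set A := Real.log (5 * r + B) - Real.log (3 * r) with hA
    have hball : ∀ y ∈ closedBall z1 (4 * r), y ∉ K ∧ ∀ n : ℕ, -A - Real.log (n + 1) ≤ u n y := by
      intro y hy
      have hyz : dist y z ≤ 5 * r := by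
        have := dist_triangle y z1 z
        rw [mem_closedBall] at hy
        rw [dist_comm z z1] at hz1
        linarith
      have hiy : 3 * r ≤ infDist y K := by
        have := infDist_le_infDist_add_dist (s := K) (x := z) (y := y)
        rw [dist_comm] at this
        linarith
      have hyK : y ∉ K := fun h => by
        rw [infDist_zero_of_mem h] at hiy
        linarith
      refine ⟨hyK, fun n => le_trans ?_ (hulow n y hyK)⟩
      have hyp : ‖y - p n‖ ≤ 5 * r + B := by
        have := norm_add_le (y - z) (z - p n)
        rw [dist_eq_norm] at hyz
        rw [sub_add_sub_cancel] at this
        linarith [hB _ (hpK n)]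
      have hyp0 : 0 < ‖y - p n‖ := norm_pos_iff.2 (sub_ne_zero.2 fun h => hyK (h ▸ hpK n))
      have e1 := Real.log_le_log hyp0 hyp
      have e2 := Real.log_le_log (by linarith) hiy
      rw [hA]
      linarith
    -- Harnack for `u n + A + log (n + 1)` costs `2 / 3` of the added constant, which must be
    -- absorbed in passing from `c n / 3` to `c n / 6`.
    have hlim : ∀ᶠ n : ℕ in atTop, 2 / 3 * (A + Real.log (n + 1)) ≤ c / 6 * n := by
      have h1 : Tendsto (fun n : ℕ => Real.log ((n : ℝ) + 1) / (n + 1)) atTop (𝓝 0) := by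
        have := (Real.isLittleO_log_id_atTop.tendsto_div_nhds_zero).comp
          (tendsto_atTop_add_const_right atTop (1 : ℝ) tendsto_natCast_atTop_atTop)
        simpa [Function.comp_def] using this
      have h2 := h1.eventually (gt_mem_nhds (show (0 : ℝ) < c / 8 by positivity))
      have h3 := (tendsto_natCast_atTop_atTop (R := ℝ)).eventually_ge_atTop (8 * |A| / c + 1)
      filter_upwards [h2, h3] with n hn2 hn3
      rw [div_lt_iff₀ (by positivity)] at hn2
      have : 8 * |A| + c ≤ c * n := by
        have := mul_le_mul_of_nonneg_left hn3 hc.le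
        rw [mul_add, mul_div_cancel₀ _ hc.ne'] at this
        linarith
      linarith [le_abs_self A, abs_nonneg A]
    obtain ⟨N', hN'⟩ := eventually_atTop.1 hlim
    refine ⟨c / 6, by positivity, r, hr0, max N N', fun n hn z' hz' => ?_⟩
    have hzz : dist z' z1 ≤ 4 * r / 2 := by
      have := dist_triangle z' z z1
      rw [mem_ball] at hz'
      linarith
    have hh := harnack_third (f := fun z => u n z + (A + Real.log (n + 1))) (c := z1) (w := z')
      (R := 4 * r) (by positivity) ?_ ?_ hzz
    · have h1 := hN n (le_trans (le_max_left _ _) hn) z1 (mem_ball_self hr1)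
      have h2 := hN' n (le_trans (le_max_right _ _) hn)
      linarith
    · simp only [hu, add_assoc]
      exact harmonicOnNhd_log_norm_prod _ _ fun i h => (hball _ h).1 (hwK n i)
    · intro y hy
      have := (hball y hy).2 n
      linarith
  have hF : IsCompact {z | δ ≤ infDist z K ∧ infDist z K ≤ 3 * D} := by
    refine Metric.isCompact_of_isClosed_isBounded ?_ ?_
    · exact (isClosed_le continuous_const (continuous_infDist_pt K)).inter
        (isClosed_le (continuous_infDist_pt K) continuous_const)
    · refine (hK.isBounded.cthickening (δ := 3 * D)).subset fun z hz => ?_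
      obtain ⟨y, hy, hzy⟩ := hK.exists_infDist_eq_dist hne z
      exact mem_cthickening_of_dist_le z y _ K hy (hzy ▸ hz.2)
  have hFN : ∃ N : ℕ, ∀ n ≥ N, ∀ z ∈ {z | δ ≤ infDist z K ∧ infDist z K ≤ 3 * D}, 1 ≤ n → 0 < u n z := by
    refine hF.induction_on (p := fun S => ∃ N : ℕ, ∀ n ≥ N, ∀ z ∈ S, 1 ≤ n → 0 < u n z) ⟨0, by simp⟩
      (fun s t hst ⟨N, hN⟩ => ⟨N, fun n hn z hz => hN n hn z (hst hz)⟩) ?_ ?_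
    · rintro s t ⟨N, hN⟩ ⟨N', hN'⟩
      refine ⟨max N N', fun n hn z hz => hz.elim (hN n (le_trans (le_max_left _ _) hn) z)
        (hN' n (le_trans (le_max_right _ _) hn) z)⟩
    · rintro z ⟨hz, -⟩
      obtain ⟨c, hc, r, hr, N, hN⟩ := hsub (fun h : z ∈ K => by
        rw [infDist_zero_of_mem h] at hz
        linarith)
      refine ⟨ball z r, mem_nhdsWithin_of_mem_nhds (ball_mem_nhds z hr), N, fun n hn z' hz' h1 => ?_⟩
      have h1' : (1 : ℝ) ≤ n := by exact_mod_cast h1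
      exact lt_of_lt_of_le (by positivity) (hN n hn z' hz')
  obtain ⟨N, hN⟩ := hFN
  refine ⟨max N 1, w _, m (max N 1), by positivity, hwK _, hm _, hle _, fun z hz => ?_⟩
  have hzK : z ∉ K := fun h => by
    rw [infDist_zero_of_mem h] at hz
    linarith
  have hupos : 0 < u (max N 1) z := by
    rcases le_total (infDist z K) (3 * D) with h | h
    · exact hN _ (le_max_left _ _) z ⟨hz, h⟩ (le_max_right _ _)
    · have h1 : (1 : ℝ) ≤ (max N 1 : ℕ) := by exact_mod_cast le_max_right N 1
      exact lt_of_lt_of_le (by linarith) (hfar _ z h)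
  simp only [hu] at hupos
  exact (Real.log_lt_log_iff (hm _) (hprod _ z hzK)).1 (by linarith)

end MatchingProblem

/-! ### Proper holomorphic maps onto a disc with a simple zero -/

namespace MatchingProblem

open Set Metric Filter Topology Complex

/-- At a diagonal point, strict differentiability handles nearby pairs with distinct entries, and
continuity of the derivative handles those with equal entries. -/
theorem continuousAt_dslope_uncurry {f : ℂ → ℂ} {V : Set ℂ} (hV : IsOpen V)
    (hf : DifferentiableOn ℂ f V) {a b : ℂ} (ha : a ∈ V) (hb : b ∈ V) :
    ContinuousAt (fun p : ℂ × ℂ => dslope f p.1 p.2) (a, b) := by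
  rcases eq_or_ne a b with rfl | hab
  · have han : AnalyticAt ℂ f a := hf.analyticAt (hV.mem_nhds ha)
    have hs : HasStrictDerivAt f (deriv f a) a := han.hasStrictDerivAt
    have hdc : ContinuousAt (deriv f) a := han.deriv.continuousAt
    rw [Metric.continuousAt_iff]
    intro ε hε
    have h1 := hs.hasStrictFDerivAt.isLittleO.def (half_pos hε)
    have h2 : ∀ᶠ p : ℂ × ℂ in 𝓝 (a, a), dist (deriv f p.1) (deriv f a) < ε :=
      (hdc.comp (f := Prod.fst) (x := (a, a)) continuousAt_fst).eventually (ball_mem_nhds _ hε)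
    rw [← Metric.eventually_nhds_iff (p := fun p : ℂ × ℂ => dist (dslope f p.1 p.2) (dslope f a a) < ε)]
    filter_upwards [h1, h2] with p hp1 hp2
    rw [dslope_same]
    rcases eq_or_ne p.1 p.2 with h | h
    · rw [← h, dslope_same]
      exact hp2
    · rw [dslope_of_ne _ h.symm, slope_def_field, dist_eq_norm]
      have hne : p.1 - p.2 ≠ 0 := sub_ne_zero.2 h
      have hne' : p.2 - p.1 ≠ 0 := sub_ne_zero.2 h.symm
      have : (f p.2 - f p.1) / (p.2 - p.1) - deriv f a =
          (f p.1 - f p.2 - (p.1 - p.2) • deriv f a) / (p.1 - p.2) := by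
        rw [smul_eq_mul]
        field_simp
        ring
      rw [this, norm_div, div_lt_iff₀ (norm_pos_iff.2 hne)]
      refine hp1.trans_lt ?_
      have := norm_pos_iff.2 hne
      nlinarith
  · have h1 : ContinuousAt (fun p : ℂ × ℂ => (f p.2 - f p.1) / (p.2 - p.1)) (a, b) := by
      have hfa : ContinuousAt f a := (hf.differentiableAt (hV.mem_nhds ha)).continuousAt
      have hfb : ContinuousAt f b := (hf.differentiableAt (hV.mem_nhds hb)).continuousAt
      refine ContinuousAt.div ?_ (by fun_prop) (sub_ne_zero.2 hab.symm)
      exact (hfb.comp (f := Prod.snd) (x := (a, b)) continuousAt_snd).sub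
        (hfa.comp (f := Prod.fst) (x := (a, b)) continuousAt_fst)
    refine h1.congr ?_
    have : ∀ᶠ p : ℂ × ℂ in 𝓝 (a, b), p.1 ≠ p.2 :=
      (isOpen_ne_fun continuous_fst continuous_snd).mem_nhds hab
    filter_upwards [this] with p hp
    rw [dslope_of_ne _ hp.symm, slope_def_field]

/-- A zero of a holomorphic function persists under small perturbations of the function. -/
theorem exists_zero_of_norm_lt {f : ℂ → ℂ} {c : ℂ} {r m : ℝ} (hr : 0 < r)
    (hf : DifferentiableOn ℂ f (closedBall c r)) (hm : ∀ z ∈ sphere c r, m ≤ ‖f z‖)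
    (hc : ‖f c‖ < m) : ∃ z ∈ closedBall c r, f z = 0 := by
  by_contra! h
  have hm0 : 0 < m := (norm_nonneg _).trans_lt hc
  have hd : DifferentiableOn ℂ (fun z => (f z)⁻¹) (closedBall c r) := hf.inv h
  -- Without a zero, the maximum principle for `1 / f` contradicts the small value at the centre.
  have hdc : DiffContOnCl ℂ (fun z => (f z)⁻¹) (ball c r) :=
    DifferentiableOn.diffContOnCl (hd.mono closure_ball_subset_closedBall)
  have := norm_le_of_forall_mem_frontier_norm_le isBounded_ball hdc (C := m⁻¹)
    (fun z hz => by
      rw [frontier_ball c hr.ne'] at hz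
      rw [norm_inv]
      exact inv_anti₀ hm0 (hm z hz)) (subset_closure (mem_ball_self hr))
  rw [norm_inv, inv_le_inv₀ (norm_pos_iff.2 (h c (mem_closedBall_self hr.le))) hm0] at this
  linarith

section ProperMap

variable {V : Set ℂ} {Ψ : ℂ → ℂ} {r₀ : ℝ}

theorem nhds_le_map_nhds_of_not_const (hV : IsOpen V) (hd : DifferentiableOn ℂ Ψ V)
    (hnc : ∀ z ∈ V, ¬ ∀ᶠ y in 𝓝 z, Ψ y = Ψ z) {z : ℂ} (hz : z ∈ V) :
    𝓝 (Ψ z) ≤ map Ψ (𝓝 z) :=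
  ((hd.analyticAt (hV.mem_nhds hz)).eventually_constant_or_nhds_le_map_nhds).resolve_left (hnc z hz)

/-- A zero of `dslope` is a double point or a critical point, so injectivity and a nonvanishing
derivative are obtained together. By properness some bad pair minimises `‖Ψ a‖`. If the minimum is
positive, the open mapping property moves `a` to a smaller value and the zero in `b` persists,
giving a better bad pair. If it is `0`, both points are `0`, where the derivative does not vanish.
-/
theorem dslope_ne_zero_of_proper (hV : IsOpen V) (hd : DifferentiableOn ℂ Ψ V)
    (hmaps : ∀ z ∈ V, ‖Ψ z‖ < r₀) (hcomp : ∀ t < r₀, IsCompact {z | z ∈ V ∧ ‖Ψ z‖ ≤ t})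
    (hz : ∀ z ∈ V, Ψ z = 0 → z = 0) (hder : deriv Ψ 0 ≠ 0)
    (hnc : ∀ z ∈ V, ¬ ∀ᶠ y in 𝓝 z, Ψ y = Ψ z) {a b : ℂ} (ha : a ∈ V) (hb : b ∈ V) :
    dslope Ψ a b ≠ 0 := by
  intro hab
  have heq : ∀ {a b}, dslope Ψ a b = 0 → Ψ a = Ψ b := fun {a b} h => by
    have := sub_smul_dslope Ψ a b
    rw [h, smul_zero] at this
    exact (sub_eq_zero.1 this.symm).symm
  set T : Set ℂ := {z | z ∈ V ∧ ‖Ψ z‖ ≤ ‖Ψ a‖} with hT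
  have hTc : IsCompact T := hcomp _ (hmaps a ha)
  set S : Set (ℂ × ℂ) := (T ×ˢ T) ∩ (fun p : ℂ × ℂ => dslope Ψ p.1 p.2) ⁻¹' {0} with hS
  have hSc : IsCompact S := by
    refine (hTc.prod hTc).of_isClosed_subset ?_ inter_subset_left
    refine ContinuousOn.preimage_isClosed_of_isClosed ?_ (hTc.prod hTc).isClosed isClosed_singleton
    exact fun p hp => (continuousAt_dslope_uncurry hV hd hp.1.1 hp.2.1).continuousWithinAt
  have habS : (a, b) ∈ S := ⟨⟨⟨ha, le_rfl⟩, hb, by rw [heq hab]⟩, hab⟩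
  have hcont : ContinuousOn (fun p : ℂ × ℂ => ‖Ψ p.1‖) S :=
    (hd.continuousOn.comp continuousOn_fst fun p hp => hp.1.1.1).norm
  obtain ⟨⟨a₁, b₁⟩, hp, hmin⟩ := hSc.exists_isMinOn ⟨_, habS⟩ hcont
  obtain ⟨⟨⟨ha₁, hat⟩, hb₁, -⟩, h0⟩ := hp
  simp only [mem_preimage, mem_singleton_iff] at h0 hat ha₁ hb₁
  have hΨ := heq h0
  by_cases hza : Ψ a₁ = 0
  · have e1 := hz a₁ ha₁ hza
    have e2 := hz b₁ hb₁ (hΨ ▸ hza)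
    rw [e1, e2, dslope_same] at h0
    exact hder h0
  have hf0 : DifferentiableOn ℂ (dslope Ψ a₁) V :=
    (differentiableOn_dslope (hV.mem_nhds ha₁)).2 hd
  have hne : ∀ᶠ z in 𝓝[≠] b₁, dslope Ψ a₁ z ≠ 0 := by
    refine ((hf0.analyticAt (hV.mem_nhds hb₁)).eventually_eq_zero_or_eventually_ne_zero).resolve_left
      fun h => hnc b₁ hb₁ ?_
    filter_upwards [h] with z hz
    rw [← heq hz, hΨ]
  obtain ⟨e, he, hball⟩ : ∃ e > 0, ∀ z ∈ closedBall b₁ e, z ∈ V ∧ (z ≠ b₁ → dslope Ψ a₁ z ≠ 0) := by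
    obtain ⟨e, he, h⟩ := Metric.eventually_nhds_iff_ball.1
      ((hV.eventually_mem hb₁).and (eventually_nhdsWithin_iff.1 hne))
    exact ⟨e / 2, half_pos he, fun z hz => h z (closedBall_subset_ball (half_lt_self he) hz)⟩
  have hsph : IsCompact (sphere b₁ e) := isCompact_sphere _ _
  obtain ⟨m, hm0, hm⟩ : ∃ m > 0, ∀ z ∈ sphere b₁ e, m ≤ ‖dslope Ψ a₁ z‖ := by
    obtain ⟨z, hz, hzmin⟩ := hsph.exists_isMinOn (NormedSpace.sphere_nonempty.2 he.le)
      (hf0.continuousOn.norm.mono fun z hz => (hball z (sphere_subset_closedBall hz)).1)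
    exact ⟨_, norm_pos_iff.2 ((hball z (sphere_subset_closedBall hz)).2 (ne_of_mem_sphere hz he.ne')),
      fun y hy => hzmin hy⟩
  have hE1 : ∀ᶠ a' in 𝓝 a₁, ∀ z ∈ sphere b₁ e, m / 2 < ‖dslope Ψ a' z‖ := by
    refine hsph.eventually_forall_of_forall_eventually fun z hz => ?_
    have := (continuousAt_dslope_uncurry hV hd ha₁ (hball z (sphere_subset_closedBall hz)).1).norm
    exact this.eventually (lt_mem_nhds (by have := hm z hz; simp only; linarith))
  have hE2 : ∀ᶠ a' in 𝓝 a₁, ‖dslope Ψ a' b₁‖ < m / 2 := by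
    have h1 := (continuousAt_dslope_uncurry hV hd ha₁ hb₁).norm.comp
      (f := fun a' : ℂ => (a', b₁)) (x := a₁) (by fun_prop)
    exact h1.eventually (gt_mem_nhds (by simp [h0]; positivity))
  have hE3 : ∃ᶠ a' in 𝓝 a₁, ‖Ψ a'‖ < ‖Ψ a₁‖ := by
    have h1 : ∃ᶠ y in 𝓝 (Ψ a₁), ‖y‖ < ‖Ψ a₁‖ := by
      have : Ψ a₁ ∈ closure (ball (0 : ℂ) ‖Ψ a₁‖) := by
        rw [closure_ball _ (norm_ne_zero_iff.2 hza)]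
        simp
      simpa using mem_closure_iff_frequently.1 this
    exact h1.filter_mono (nhds_le_map_nhds_of_not_const hV hd hnc ha₁)
  obtain ⟨a', hlt, ⟨h1, h2⟩, ha'⟩ := (hE3.and_eventually ((hE1.and hE2).and (hV.eventually_mem ha₁))).exists
  obtain ⟨b', hb', hb0⟩ := exists_zero_of_norm_lt he
    (((differentiableOn_dslope (hV.mem_nhds ha')).2 hd).mono fun z hz => (hball z hz).1)
    (fun z hz => (h1 z hz).le) h2
  have hmem : (a', b') ∈ S := by
    refine ⟨⟨⟨ha', hlt.le.trans hat⟩, (hball b' hb').1, ?_⟩, hb0⟩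
    simp only
    rw [← heq hb0]
    exact hlt.le.trans hat
  exact absurd (hmin hmem) (not_le.2 hlt)

/-- Surjectivity: the image is open, and relatively closed in the disc by properness. Injectivity
and differentiability of the inverse both come from `dslope_ne_zero_of_proper`. -/
theorem exists_inverse_of_proper (hV : IsOpen V) (hd : DifferentiableOn ℂ Ψ V)
    (hmaps : ∀ z ∈ V, ‖Ψ z‖ < r₀) (hcomp : ∀ t < r₀, IsCompact {z | z ∈ V ∧ ‖Ψ z‖ ≤ t})
    (hne : V.Nonempty)
    (hz : ∀ z ∈ V, Ψ z = 0 → z = 0) (hder : deriv Ψ 0 ≠ 0)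
    (hnc : ∀ z ∈ V, ¬ ∀ᶠ y in 𝓝 z, Ψ y = Ψ z) :
    ∃ X : ℂ → ℂ, DifferentiableOn ℂ X (ball 0 r₀) ∧ (∀ y ∈ ball 0 r₀, X y ∈ V ∧ Ψ (X y) = y) ∧
      ∀ z ∈ V, X (Ψ z) = z := by
  have hG : ∀ {a b}, a ∈ V → b ∈ V → dslope Ψ a b ≠ 0 := fun ha hb =>
    dslope_ne_zero_of_proper hV hd hmaps hcomp hz hder hnc ha hb
  have hinj : InjOn Ψ V := by
    intro a ha b hb hab
    by_contra hne
    have := sub_smul_dslope Ψ a b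
    rw [hab, sub_self, smul_eq_mul, mul_eq_zero] at this
    exact this.elim (fun h => hne (sub_eq_zero.1 h).symm) (hG ha hb)
  have hmap : ∀ z ∈ V, 𝓝 (Ψ z) ≤ map Ψ (𝓝 z) := fun z hz =>
    nhds_le_map_nhds_of_not_const hV hd hnc hz
  have hopen : IsOpen (Ψ '' V) := by
    rw [isOpen_iff_mem_nhds]
    rintro _ ⟨z, hz, rfl⟩
    exact hmap z hz (image_mem_map (hV.mem_nhds hz))
  have hsurj : ball 0 r₀ ⊆ Ψ '' V := by
    refine isPreconnected_ball.subset_of_closure_inter_subset hopen ?_ ?_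
    · obtain ⟨z, hz⟩ := hne
      exact ⟨Ψ z, by simpa using hmaps z hz, z, hz, rfl⟩
    · rintro y ⟨hy, hyb⟩
      rw [mem_ball_zero_iff] at hyb
      obtain ⟨t, ht1, ht2⟩ := exists_between hyb
      have hcl : IsClosed (Ψ '' {z | z ∈ V ∧ ‖Ψ z‖ ≤ t}) :=
        ((hcomp t ht2).image_of_continuousOn (hd.continuousOn.mono fun z hz => hz.1)).isClosed
      have h1 : y ∈ closure (ball 0 t ∩ Ψ '' V) :=
        isOpen_ball.inter_closure ⟨by simpa using ht1, hy⟩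
      have h2 : ball 0 t ∩ Ψ '' V ⊆ Ψ '' {z | z ∈ V ∧ ‖Ψ z‖ ≤ t} := by
        rintro _ ⟨h, z, hz, rfl⟩
        exact ⟨z, ⟨hz, by simpa using (mem_ball_zero_iff.1 h).le⟩, rfl⟩
      exact image_mono (fun z hz => hz.1) (closure_minimal h2 hcl h1)
  refine ⟨Function.invFunOn Ψ V, ?_, fun y hy => ?_, fun z hz => ?_⟩
  · intro y hy
    obtain ⟨z, hz, rfl⟩ := hsurj hy
    have hXz : Function.invFunOn Ψ V (Ψ z) = z := hinj.leftInvOn_invFunOn hz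
    have hc : ContinuousAt (Function.invFunOn Ψ V) (Ψ z) := by
      intro N hN
      rw [hXz] at hN
      have hNV : Ψ '' (N ∩ V) ∈ 𝓝 (Ψ z) :=
        hmap z hz (image_mem_map (inter_mem hN (hV.mem_nhds hz)))
      refine mem_map.2 (mem_of_superset hNV ?_)
      rintro _ ⟨x, ⟨hxN, hxV⟩, rfl⟩
      rw [mem_preimage, hinj.leftInvOn_invFunOn hxV]
      exact hxN
    have hder' : HasDerivAt Ψ (deriv Ψ z) (Function.invFunOn Ψ V (Ψ z)) := by
      rw [hXz]
      exact (hd.differentiableAt (hV.mem_nhds hz)).hasDerivAt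
    have hnz : deriv Ψ z ≠ 0 := by
      have := hG hz hz
      rwa [dslope_same] at this
    refine (hder'.of_local_left_inverse hc hnz ?_).differentiableAt.differentiableWithinAt
    filter_upwards [isOpen_ball.mem_nhds hy] with y hy
    exact Function.invFunOn_eq (hsurj hy)
  · exact ⟨Function.invFunOn_mem (hsurj hy), Function.invFunOn_eq (hsurj hy)⟩
  · exact hinj.leftInvOn_invFunOn hz

end ProperMap

end MatchingProblem

/-! ### The exterior conformal coordinate of a lemniscate -/

namespace MatchingProblem

open Set Metric Filter Topology Complex

/-- Having a quotient with a holomorphic logarithm on `V` is an equivalence relation between points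
of `K`. Nearby points are related because the quotient is within `1` of `1`, so connectedness of `K`
links `x` to `b`, whose function is `1`. No topological assumption on `V` is needed. -/
theorem exists_log_one_sub_mul {K V : Set ℂ} (hK : IsPreconnected K) {b : ℂ} (hb : b ∈ K)
    {δ : ℝ} (hδ : 0 < δ) (hne : ∀ ζ ∈ V, ∀ x ∈ K, 1 - (x - b) * ζ ≠ 0)
    (hV : ∀ ζ ∈ V, ∀ x ∈ K, δ * ‖ζ‖ ≤ ‖1 - (x - b) * ζ‖) {x : ℂ} (hx : x ∈ K) :
    ∃ L : ℂ → ℂ, DifferentiableOn ℂ L V ∧ ∀ ζ ∈ V, exp (L ζ) = 1 - (x - b) * ζ := by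
  have key : ∃ L : ℂ → ℂ, DifferentiableOn ℂ L V ∧
      ∀ ζ ∈ V, exp (L ζ) * (1 - (b - b) * ζ) = 1 - (x - b) * ζ := by
    refine hK.induction₂ (fun x y => ∃ L : ℂ → ℂ, DifferentiableOn ℂ L V ∧
      ∀ ζ ∈ V, exp (L ζ) * (1 - (y - b) * ζ) = 1 - (x - b) * ζ) ?_ ?_ ?_ hx hb
    · intro x hx
      filter_upwards [mem_nhdsWithin_of_mem_nhds (ball_mem_nhds x hδ), self_mem_nhdsWithin]
        with y hy hyK
      have hslit : ∀ ζ ∈ V, 1 + (y - x) * ζ / (1 - (y - b) * ζ) ∈ slitPlane := by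
        intro ζ hζ
        apply mem_slitPlane_of_norm_lt_one
        have h1 := norm_pos_iff.2 (hne ζ hζ y hyK)
        rw [norm_div, div_lt_one h1, norm_mul]
        rw [mem_ball, dist_eq_norm] at hy
        rcases eq_or_ne ζ 0 with rfl | h0
        · simp
        · exact (mul_lt_mul_of_pos_right hy (norm_pos_iff.2 h0)).trans_le (hV ζ hζ y hyK)
      refine ⟨fun ζ => log (1 + (y - x) * ζ / (1 - (y - b) * ζ)), ?_, fun ζ hζ => ?_⟩
      · intro ζ hζ
        have h1 := hne ζ hζ y hyK
        have hdiff : DifferentiableAt ℂ (fun ζ => 1 + (y - x) * ζ / (1 - (y - b) * ζ)) ζ := by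
          fun_prop (disch := assumption)
        exact (hdiff.clog (hslit ζ hζ)).differentiableWithinAt
      · have h1 := hne ζ hζ y hyK
        rw [exp_log (slitPlane_ne_zero (hslit ζ hζ)), add_mul, div_mul_cancel₀ _ h1]
        ring
    · rintro x y z - - - ⟨L, hL, h⟩ ⟨L', hL', h'⟩
      refine ⟨fun ζ => L ζ + L' ζ, hL.add hL', fun ζ hζ => ?_⟩
      rw [exp_add, mul_assoc, h' ζ hζ, h ζ hζ]
    · rintro x y - - ⟨L, hL, h⟩
      refine ⟨fun ζ => -L ζ, hL.neg, fun ζ hζ => ?_⟩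
      rw [exp_neg, ← h ζ hζ, inv_mul_cancel_left₀ (exp_ne_zero _)]
  simpa using key

/-- The exterior conformal coordinate of a lemniscate whose nodes lie in a connected set inside. -/
theorem exists_exterior_coordinate {K : Set ℂ} (hK : IsCompact K) (hconn : IsConnected K)
    {n : ℕ} (hn : 0 < n) {w : Fin n → ℂ} (hw : ∀ i, w i ∈ K) {M : ℝ} (hM : 0 < M)
    (hMK : ∀ z ∈ K, ∏ i, ‖z - w i‖ < M) :
    ∃ (r₀ : ℝ) (ω ψ : ℂ → ℂ), 0 < r₀ ∧ r₀ ^ n * M = 1 ∧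
      ContinuousOn ω {z | M < ∏ i, ‖z - w i‖} ∧
      DifferentiableOn ℂ ψ (ball 0 r₀ \ {0}) ∧
      (∀ z, M < ∏ i, ‖z - w i‖ → ω z ∈ ball 0 r₀ \ {0} ∧ ψ (ω z) = z) ∧
      ∀ y ∈ ball 0 r₀ \ {0}, ω (ψ y) = y ∧ ‖y‖ ^ n * ∏ i, ‖ψ y - w i‖ = 1 := by
  obtain ⟨b, hb⟩ := hconn.nonempty
  have hqc : Continuous fun z : ℂ => ∏ i, ‖z - w i‖ := by fun_prop
  obtain ⟨δ, hδ, hth⟩ := hK.exists_thickening_subset_open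
    (isOpen_lt hqc continuous_const) (show K ⊆ {z | ∏ i, ‖z - w i‖ < M} from hMK)
  have hfar : ∀ z, M < ∏ i, ‖z - w i‖ → ∀ x ∈ K, δ ≤ ‖z - x‖ := by
    intro z hz x hx
    by_contra! h
    have : z ∈ thickening δ K := mem_thickening_iff.2 ⟨x, hx, by rwa [dist_eq_norm]⟩
    exact absurd (hth this) (not_lt.2 hz.le)
  -- In the coordinate `ζ = 1 / (z - b)`, `P` is `ζ ^ n` times the polynomial. The exterior becomes
  -- `V`, with `∞` included as `ζ = 0`, and `Ψ = ζ P^(-1/n)` is the desired map.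
  set P : ℂ → ℂ := fun ζ => ∏ i, (1 - (w i - b) * ζ) with hP
  have hPd : Differentiable ℂ P := by fun_prop
  have hP0 : P 0 = 1 := by simp [hP]
  set V : Set ℂ := {ζ | M * ‖ζ‖ ^ n < ‖P ζ‖} with hVdef
  have hVo : IsOpen V := isOpen_lt (by fun_prop) hPd.continuous.norm
  have h0V : (0 : ℂ) ∈ V := by simp [hVdef, hP0, hn.ne']
  have hfac : ∀ ζ : ℂ, ζ ≠ 0 → ∀ x, 1 - (x - b) * ζ = ζ * ((b + ζ⁻¹) - x) := by
    intro ζ hζ x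
    field_simp
    ring
  have hPq : ∀ ζ ≠ 0, ‖P ζ‖ = ‖ζ‖ ^ n * ∏ i, ‖(b + ζ⁻¹) - w i‖ := by
    intro ζ hζ
    simp only [hP, hfac ζ hζ, norm_prod, norm_mul, norm_pow, Finset.prod_mul_distrib, Finset.prod_const,
      Finset.card_univ, Fintype.card_fin]
  have hVU : ∀ ζ ≠ 0, ζ ∈ V ↔ M < ∏ i, ‖(b + ζ⁻¹) - w i‖ := by
    intro ζ hζ
    have : 0 < ‖ζ‖ ^ n := pow_pos (norm_pos_iff.2 hζ) n
    rw [hVdef, mem_ofPred_eq, hPq ζ hζ, mul_comm, mul_lt_mul_iff_right₀ this]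
  have hVδ : ∀ ζ ∈ V, ∀ x ∈ K, δ * ‖ζ‖ ≤ ‖1 - (x - b) * ζ‖ := by
    intro ζ hζ x hx
    rcases eq_or_ne ζ 0 with rfl | h0
    · simp
    · rw [hfac ζ h0, norm_mul, mul_comm]
      gcongr
      exact hfar _ ((hVU ζ h0).1 hζ) x hx
  have hVne : ∀ ζ ∈ V, ∀ x ∈ K, 1 - (x - b) * ζ ≠ 0 := by
    intro ζ hζ x hx h
    rcases eq_or_ne ζ 0 with rfl | h0
    · simp at h
    · have := hVδ ζ hζ x hx
      rw [h, norm_zero] at this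
      have := mul_pos hδ (norm_pos_iff.2 h0)
      linarith
  have hlog : ∀ i, ∃ L : ℂ → ℂ, DifferentiableOn ℂ L V ∧ ∀ ζ ∈ V, exp (L ζ) = 1 - (w i - b) * ζ :=
    fun i => exists_log_one_sub_mul hconn.isPreconnected hb hδ hVne hVδ (hw i)
  choose L hLd hL using hlog
  set E : ℂ → ℂ := fun ζ => exp (-(∑ i, L i ζ) / n) with hE
  have hEd : DifferentiableOn ℂ E V := by
    have : DifferentiableOn ℂ (fun ζ => ∑ i, L i ζ) V := DifferentiableOn.fun_sum fun i _ => hLd i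
    exact (this.neg.div_const _).cexp
  set Ψ : ℂ → ℂ := fun ζ => ζ * E ζ with hΨ
  have hΨd : DifferentiableOn ℂ Ψ V := differentiableOn_id.mul hEd
  have hn' : (n : ℂ) ≠ 0 := by exact_mod_cast hn.ne'
  have hΨP : ∀ ζ ∈ V, Ψ ζ ^ n * P ζ = ζ ^ n := by
    intro ζ hζ
    have h1 : P ζ = exp (∑ i, L i ζ) := by
      rw [exp_sum]
      exact Finset.prod_congr rfl fun i _ => (hL i ζ hζ).symm
    have h2 : E ζ ^ n = exp (-(∑ i, L i ζ)) := by
      rw [hE, ← exp_nat_mul]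
      congr 1
      field_simp
    rw [hΨ, mul_pow, h2, h1, mul_assoc, ← exp_add, neg_add_cancel, exp_zero, mul_one]
  have hΨPn : ∀ ζ ∈ V, ‖Ψ ζ‖ ^ n * ‖P ζ‖ = ‖ζ‖ ^ n := by
    intro ζ hζ
    rw [← norm_pow, ← norm_mul, hΨP ζ hζ, norm_pow]
  have hPpos : ∀ ζ ∈ V, 0 < ‖P ζ‖ := fun ζ hζ => lt_of_le_of_lt (by positivity) hζ
  set r₀ : ℝ := (1 / M) ^ ((n : ℝ)⁻¹) with hr₀
  have hr₀pos : 0 < r₀ := by positivity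
  have hr₀n : r₀ ^ n = 1 / M := Real.rpow_inv_natCast_pow (by positivity) hn.ne'
  have hmaps : ∀ ζ ∈ V, ‖Ψ ζ‖ < r₀ := by
    intro ζ hζ
    refine lt_of_pow_lt_pow_left₀ n hr₀pos.le ?_
    rw [hr₀n, lt_div_iff₀ hM]
    have h1 := hΨPn ζ hζ
    have h2 : M * ‖ζ‖ ^ n < ‖P ζ‖ := hζ
    rw [← h1] at h2
    have h3 := hPpos ζ hζ
    by_contra! hcon
    nlinarith
  have hVb : ∀ ζ ∈ V, ‖ζ‖ ≤ 1 / δ := by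
    intro ζ hζ
    rcases eq_or_ne ζ 0 with rfl | h0
    · simp [hδ.le]
    · have := hfar _ ((hVU ζ h0).1 hζ) b hb
      rw [add_sub_cancel_left, norm_inv] at this
      rw [le_div_iff₀ hδ]
      have h1 := mul_le_mul_of_nonneg_left this (norm_nonneg ζ)
      rwa [mul_inv_cancel₀ (norm_ne_zero_iff.2 h0)] at h1
  have hcomp : ∀ t < r₀, IsCompact {z | z ∈ V ∧ ‖Ψ z‖ ≤ t} := by
    intro t ht
    rcases lt_or_ge t 0 with ht0 | ht0
    · convert isCompact_empty
      ext z
      simp only [mem_ofPred_eq, mem_empty_iff_false, iff_false, not_and, not_le]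
      exact fun _ => ht0.trans_le (norm_nonneg _)
    -- Rewriting the set through continuous functions on all of `ℂ` shows it closed; `t < r₀` makes
    -- membership in `V` automatic.
    have hset : {z | z ∈ V ∧ ‖Ψ z‖ ≤ t} = {z | ‖z‖ ^ n ≤ t ^ n * ‖P z‖} := by
      ext ζ
      constructor
      · rintro ⟨hζ, hle⟩
        rw [mem_ofPred_eq, ← hΨPn ζ hζ]
        gcongr
      · intro h
        rw [mem_ofPred_eq] at h
        have hP1 : 0 < ‖P ζ‖ := by
          refine norm_pos_iff.2 fun h0 => ?_
          rw [h0, norm_zero, mul_zero] at h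
          have : ζ = 0 := by
            have := pow_eq_zero_iff hn.ne' |>.1 (le_antisymm h (by positivity))
            simpa using this
          rw [this, hP0] at h0
          exact one_ne_zero h0
        have htn : t ^ n < 1 / M := hr₀n ▸ pow_lt_pow_left₀ ht ht0 hn.ne'
        rw [lt_div_iff₀ hM] at htn
        have hζ : ζ ∈ V := by
          rw [hVdef, mem_ofPred_eq]
          nlinarith
        refine ⟨hζ, le_of_pow_le_pow_left₀ hn.ne' ht0 ?_⟩
        rw [← hΨPn ζ hζ] at h
        exact le_of_mul_le_mul_right h hP1
    refine Metric.isCompact_of_isClosed_isBounded ?_ ?_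
    · rw [hset]
      exact isClosed_le (by fun_prop) (continuous_const.mul hPd.continuous.norm)
    · exact isBounded_closedBall.subset fun z hz => mem_closedBall_zero_iff.2 (hVb z hz.1)
  have hzero : ∀ z ∈ V, Ψ z = 0 → z = 0 := by
    intro z _ h
    exact (mul_eq_zero.1 h).resolve_right (exp_ne_zero _)
  have hder : deriv Ψ 0 ≠ 0 := by
    have := (hasDerivAt_id (0 : ℂ)).mul (hEd.differentiableAt (hVo.mem_nhds h0V)).hasDerivAt
    have h2 : deriv Ψ 0 = _ := this.deriv
    rw [h2]
    simp [hE, exp_ne_zero]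
  have hnc : ∀ z ∈ V, ¬ ∀ᶠ y in 𝓝 z, Ψ y = Ψ z := by
    intro z hz h
    -- Local constancy would make `ζ ^ n` a constant multiple of `P`; the value at `0` makes that
    -- constant zero, and the value at `1` is then contradictory.
    have heq : (fun y => Ψ z ^ n * P y) =ᶠ[𝓝 z] fun y => y ^ n := by
      filter_upwards [h, hVo.mem_nhds hz] with y hy hyV
      rw [← hy, hΨP y hyV]
    have hall := AnalyticOnNhd.eq_of_eventuallyEq (𝕜 := ℂ)
      (fun y _ => (Differentiable.analyticAt (by fun_prop) y)) (fun y _ => by fun_prop) heq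
    have h1 := congrFun hall 0
    have h2 := congrFun hall 1
    simp only [hP0, mul_one, zero_pow hn.ne'] at h1
    simp [h1] at h2
  obtain ⟨X, hXd, hX, hXΨ⟩ := exists_inverse_of_proper hVo hΨd hmaps hcomp ⟨0, h0V⟩ hzero hder hnc
  have hX0 : ∀ y ∈ ball 0 r₀ \ {0}, X y ≠ 0 := by
    rintro y ⟨hy, hy0⟩ h
    have := (hX y hy).2
    rw [h] at this
    exact hy0 (by simp [← this, hΨ])
  have hUV : ∀ z, M < ∏ i, ‖z - w i‖ → (z - b)⁻¹ ≠ 0 ∧ (z - b)⁻¹ ∈ V := by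
    intro z hz
    have h1 : z - b ≠ 0 := sub_ne_zero.2 fun h => absurd (hMK b hb) (not_lt.2 (h ▸ hz.le))
    refine ⟨inv_ne_zero h1, (hVU _ (inv_ne_zero h1)).2 ?_⟩
    rwa [inv_inv, add_sub_cancel]
  refine ⟨r₀, fun z => Ψ (z - b)⁻¹, fun y => b + (X y)⁻¹, hr₀pos, ?_, ?_, ?_, ?_, ?_⟩
  · rw [hr₀n]
    field_simp
  · refine hΨd.continuousOn.comp (ContinuousOn.inv₀ (by fun_prop) fun z hz => ?_) fun z hz => (hUV z hz).2
    exact fun h => (hUV z hz).1 (by rw [h, inv_zero])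
  · exact ((hXd.mono sdiff_subset).inv hX0).const_add b
  · intro z hz
    obtain ⟨h1, h2⟩ := hUV z hz
    refine ⟨⟨mem_ball_zero_iff.2 (hmaps _ h2), fun h => h1 (hzero _ h2 h)⟩, ?_⟩
    simp only [hXΨ _ h2, inv_inv, add_sub_cancel]
  · intro y hy
    refine ⟨by simp only [add_sub_cancel_left, inv_inv, (hX y hy.1).2], ?_⟩
    have h1 := hΨPn _ (hX y hy.1).1
    have h0 := hX0 y hy
    rw [(hX y hy.1).2, hPq _ h0] at h1
    have h2 : 0 < ‖X y‖ ^ n := pow_pos (norm_pos_iff.2 h0) n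
    refine mul_left_cancel₀ h2.ne' ?_
    rw [mul_one, mul_left_comm]
    exact h1

end MatchingProblem

/-! ### Images of annular curves: components of the complement and distance to `K` -/

namespace MatchingProblem

open Set Metric Filter Topology Complex
open scoped OnePoint

/-- `ω` and `ψ` are mutually inverse conformal coordinates between the exterior
`{M < ∏ ‖z - w i‖}` of a lemniscate and the punctured disc of radius `r₀`. -/
structure IsExteriorCoordinate {n : ℕ} (w : Fin n → ℂ) (M r₀ : ℝ) (ω ψ : ℂ → ℂ) : Prop where
  n_pos : 0 < n
  M_pos : 0 < M
  radius_pos : 0 < r₀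
  radius_pow : r₀ ^ n * M = 1
  continuousOn : ContinuousOn ω {z | M < ∏ i, ‖z - w i‖}
  differentiableOn : DifferentiableOn ℂ ψ (ball 0 r₀ \ {0})
  left_inv : ∀ z, M < ∏ i, ‖z - w i‖ → ω z ∈ ball 0 r₀ \ {0} ∧ ψ (ω z) = z
  right_inv : ∀ y ∈ ball 0 r₀ \ {0}, ω (ψ y) = y ∧ ‖y‖ ^ n * ∏ i, ‖ψ y - w i‖ = 1

/-- `C` is a Jordan curve in the closed disc of radius `r₁` which bounds the open set `O`
containing the closed disc of radius `ρ`. -/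
structure IsAnnularCurve (O C : Set ℂ) (ρ r₁ : ℝ) : Prop where
  isOpen : IsOpen O
  pos : 0 < ρ
  closedBall_subset : closedBall 0 ρ ⊆ O
  jordan : IsJordanCurve C
  subset_closedBall : O ∪ C ⊆ closedBall 0 r₁
  isClosed : IsClosed (O ∪ C)
  disjoint : Disjoint O C
  preconnected : IsPreconnected (O \ {0})

theorem exists_subarc {Γ : Set ℂ} (hΓ : IsJordanCurve Γ) {ε : ℝ} (hε : 0 < ε) :
    ∃ σ : C(unitInterval, ℂ), Function.Injective σ ∧ range σ ⊆ Γ ∧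
      ∀ z ∈ Γ, ∃ k ∈ range σ, dist z k < ε := by
  obtain ⟨γ, hγ, hinj, rfl⟩ := hΓ
  have hπ := Real.pi_pos
  have hf : Continuous fun θ : ℝ => γ (Circle.exp θ) := by fun_prop
  obtain ⟨η', hη', h⟩ := Metric.continuous_iff.1 hf (-Real.pi) ε hε
  set η := min (η' / 2) Real.pi with hηdef
  have hη : 0 < η := lt_min (by positivity) hπ
  have hη1 : η < η' := (min_le_left _ _).trans_lt (by linarith)
  have hη2 : η ≤ Real.pi := min_le_right _ _
  -- Affine parametrisation of the angles in `[-π + η, π]`. The omitted angles are within `η'` of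
  -- `-π`, so their images are close to the endpoint at angle `π`.
  set l : ℝ → ℝ := fun t => -Real.pi + η + (2 * Real.pi - η) * t with hl
  have hlI : ∀ t ∈ Icc (0 : ℝ) 1, -Real.pi < l t ∧ l t ≤ Real.pi := by
    intro t ht
    constructor
    · have := mul_nonneg (show 0 ≤ 2 * Real.pi - η by linarith) ht.1
      simp only [hl]
      linarith
    · have := mul_le_mul_of_nonneg_left ht.2 (show 0 ≤ 2 * Real.pi - η by linarith)
      simp only [hl]
      linarith
  refine ⟨⟨fun t => γ (Circle.exp (l t)), by fun_prop⟩, ?_, ?_, ?_⟩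
  · intro s t hst
    have h1 : l s = l t := by
      rw [← Circle.arg_exp (hlI s s.2).1 (hlI s s.2).2, ← Circle.arg_exp (hlI t t.2).1 (hlI t t.2).2]
      exact congrArg (fun c : Circle => (c : ℂ).arg) (hinj hst)
    simp only [hl] at h1
    have : (2 * Real.pi - η) ≠ 0 := by linarith
    exact Subtype.ext (mul_left_cancel₀ this (by linarith))
  · rintro _ ⟨t, rfl⟩
    exact mem_range_self _
  · rintro _ ⟨c, rfl⟩
    have h1 := neg_pi_lt_arg (c : ℂ)
    have h2 := arg_le_pi (c : ℂ)
    have hc : Circle.exp (arg (c : ℂ)) = c := Circle.exp_arg c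
    rcases le_or_gt (-Real.pi + η) (arg (c : ℂ)) with h3 | h3
    · have hp : 0 < 2 * Real.pi - η := by linarith
      refine ⟨_, ⟨⟨(arg (c : ℂ) + Real.pi - η) / (2 * Real.pi - η), by
        rw [mem_Icc]
        exact ⟨div_nonneg (by linarith) hp.le, (div_le_one hp).2 (by linarith)⟩⟩, rfl⟩, ?_⟩
      have : l ((arg (c : ℂ) + Real.pi - η) / (2 * Real.pi - η)) = arg (c : ℂ) := by
        simp only [hl]
        rw [mul_div_cancel₀ _ hp.ne']
        ring
      simp only [ContinuousMap.coe_mk, this, hc, dist_self]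
      exact hε
    · refine ⟨_, ⟨1, rfl⟩, ?_⟩
      have h4 := h (arg (c : ℂ)) (by rw [Real.dist_eq, abs_of_pos (by linarith)]; linarith)
      have h5 : l ((1 : unitInterval) : ℝ) = -Real.pi + 2 * Real.pi := by
        simp only [hl, Icc.coe_one]
        ring
      have h6 : Circle.exp (-Real.pi + 2 * Real.pi) = Circle.exp (-Real.pi) := by
        rw [Circle.exp_add, Circle.exp_two_pi, mul_one]
      rw [hc] at h4
      simpa only [ContinuousMap.coe_mk, h5, h6] using h4

/-- Supplies, near each point of `K`, a point that will lie outside the approximating curve; a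
segment between the two must then cross the curve. -/
theorem exists_uniform_far_points {K : Set ℂ} (hK : IsCompact K) (hne : K.Nonempty)
    (hint : interior K = ∅)
    {ε : ℝ} (hε : 0 < ε) :
    ∃ δ > 0, ∀ k ∈ K, ∃ d, dist k d < ε ∧ δ ≤ infDist d K := by
  refine hK.induction_on (p := fun S => ∃ δ > 0, ∀ k ∈ S, ∃ d, dist k d < ε ∧ δ ≤ infDist d K)
    ⟨1, one_pos, by simp⟩ (fun s t hst ⟨δ, hδ, h⟩ => ⟨δ, hδ, fun k hk => h k (hst hk)⟩) ?_ ?_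
  · rintro s t ⟨δ, hδ, h⟩ ⟨δ', hδ', h'⟩
    refine ⟨min δ δ', lt_min hδ hδ', fun k hk => hk.elim (fun hk => ?_) fun hk => ?_⟩
    · obtain ⟨d, h1, h2⟩ := h k hk
      exact ⟨d, h1, (min_le_left _ _).trans h2⟩
    · obtain ⟨d, h1, h2⟩ := h' k hk
      exact ⟨d, h1, (min_le_right _ _).trans h2⟩
  · intro k hk
    have hdense : Dense Kᶜ := interior_eq_empty_iff_dense_compl.1 hint
    obtain ⟨d, hd, hkd⟩ := hdense.exists_dist_lt k (half_pos hε)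
    refine ⟨ball k (ε / 2), mem_nhdsWithin_of_mem_nhds (ball_mem_nhds _ (half_pos hε)), infDist d K,
      (hK.isClosed.notMem_iff_infDist_pos hne).1 hd, fun k' hk' => ⟨d, ?_, le_rfl⟩⟩
    rw [mem_ball] at hk'
    linarith [dist_triangle k' k d]

theorem isBounded_prod_norm_le {n : ℕ} (hn : 0 < n) (w : Fin n → ℂ) (T : ℝ) :
    Bornology.IsBounded {z | ∏ i, ‖z - w i‖ ≤ T} := by
  refine isBounded_closedBall.subset (t := closedBall 0 (1 + |T| + ∑ i, ‖w i‖)) fun z hz => ?_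
  rw [mem_closedBall_zero_iff]
  by_contra! h
  have h1 : ∀ i, 1 + |T| ≤ ‖z - w i‖ := by
    intro i
    have h2 : ‖w i‖ ≤ ∑ i, ‖w i‖ :=
      Finset.single_le_sum (f := fun i => ‖w i‖) (fun i _ => norm_nonneg _) (Finset.mem_univ i)
    linarith [norm_sub_norm_le z (w i)]
  have h3 : (1 + |T|) ^ n ≤ ∏ i, ‖z - w i‖ := by
    have := Finset.prod_le_prod (s := Finset.univ) (f := fun _ : Fin n => 1 + |T|)
      (g := fun i => ‖z - w i‖) (fun i _ => by positivity) (fun i _ => h1 i)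
    simpa using this
  have h4 : 1 + |T| ≤ (1 + |T|) ^ n := le_self_pow₀ (by linarith [abs_nonneg T]) hn.ne'
  rw [mem_ofPred_eq] at hz
  linarith [le_abs_self T]

namespace IsExteriorCoordinate

variable {n : ℕ} {w : Fin n → ℂ} {M r₀ : ℝ} {ω ψ : ℂ → ℂ} {O C : Set ℂ} {ρ r₁ : ℝ}

theorem lt_prod (h : IsExteriorCoordinate w M r₀ ω ψ) {y : ℂ} (hy : y ∈ ball 0 r₀ \ {0}) :
    M < ∏ i, ‖ψ y - w i‖ := by
  have h1 := (h.right_inv y hy).2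
  have h2 : 0 < ‖y‖ := norm_pos_iff.2 hy.2
  have h3 : ‖y‖ ^ n < r₀ ^ n :=
    pow_lt_pow_left₀ (mem_ball_zero_iff.1 hy.1) h2.le h.n_pos.ne'
  have h4 : ‖y‖ ^ n * M < ‖y‖ ^ n * ∏ i, ‖ψ y - w i‖ := by
    rw [h1, ← h.radius_pow]
    exact mul_lt_mul_of_pos_right h3 h.M_pos
  exact lt_of_mul_lt_mul_left h4 (by positivity)

theorem injOn (h : IsExteriorCoordinate w M r₀ ω ψ) : InjOn ψ (ball 0 r₀ \ {0}) :=
  fun a ha b hb hab => by rw [← (h.right_inv a ha).1, hab, (h.right_inv b hb).1]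

theorem mem_image_iff (h : IsExteriorCoordinate w M r₀ ω ψ) {S : Set ℂ}
    (hS : S ⊆ ball 0 r₀ \ {0}) {z : ℂ} : z ∈ ψ '' S ↔ M < ∏ i, ‖z - w i‖ ∧ ω z ∈ S := by
  constructor
  · rintro ⟨y, hy, rfl⟩
    exact ⟨h.lt_prod (hS hy), by rwa [(h.right_inv y (hS hy)).1]⟩
  · rintro ⟨h1, h2⟩
    exact ⟨ω z, h2, (h.left_inv z h1).2⟩

theorem isOpen_exterior (w : Fin n → ℂ) (M : ℝ) : IsOpen {z | M < ∏ i, ‖z - w i‖} :=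
  isOpen_lt continuous_const (by fun_prop)

end IsExteriorCoordinate

end MatchingProblem

namespace MatchingProblem

open Set Metric Filter Topology Complex
open scoped OnePoint

namespace IsAnnularCurve

variable {O C : Set ℂ} {ρ r₁ r₀ : ℝ}

theorem zero_mem (hC : IsAnnularCurve O C ρ r₁) : (0 : ℂ) ∈ O :=
  hC.closedBall_subset (mem_closedBall_self hC.pos.le)

theorem zero_notMem (hC : IsAnnularCurve O C ρ r₁) : (0 : ℂ) ∉ C :=
  fun h => hC.disjoint.le_bot ⟨hC.zero_mem, h⟩

theorem sdiff_subset (hC : IsAnnularCurve O C ρ r₁) (hr : r₁ < r₀) :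
    (O ∪ C) \ {0} ⊆ ball 0 r₀ \ {0} :=
  sdiff_subset_sdiff_left (hC.subset_closedBall.trans (closedBall_subset_ball hr))

theorem curve_subset_sdiff (hC : IsAnnularCurve O C ρ r₁) : C ⊆ (O ∪ C) \ {0} :=
  fun _ hy => ⟨Or.inr hy, fun h => hC.zero_notMem (h ▸ hy)⟩

theorem open_sdiff_subset (_hC : IsAnnularCurve O C ρ r₁) : O \ {0} ⊆ (O ∪ C) \ {0} :=
  sdiff_subset_sdiff_left subset_union_left

end IsAnnularCurve

namespace IsExteriorCoordinate

variable {n : ℕ} {w : Fin n → ℂ} {M r₀ : ℝ} {ω ψ : ℂ → ℂ} {O C : Set ℂ} {ρ r₁ : ℝ}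

theorem isOpen_image (h : IsExteriorCoordinate w M r₀ ω ψ) (hC : IsAnnularCurve O C ρ r₁)
    (hr : r₁ < r₀) : IsOpen (ψ '' (O \ {0})) := by
  have : ψ '' (O \ {0}) = {z | M < ∏ i, ‖z - w i‖} ∩ ω ⁻¹' (O \ {0}) := by
    ext z
    exact h.mem_image_iff (hC.open_sdiff_subset.trans (hC.sdiff_subset hr))
  rw [this]
  exact h.continuousOn.isOpen_inter_preimage (isOpen_exterior w M)
    (hC.isOpen.sdiff isClosed_singleton)

theorem isOpen_compl_image (h : IsExteriorCoordinate w M r₀ ω ψ) (hC : IsAnnularCurve O C ρ r₁)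
    (hr : r₁ < r₀) : IsOpen (ψ '' ((O ∪ C) \ {0}))ᶜ := by
  have hρ : closedBall (0 : ℂ) ρ ⊆ closedBall 0 r₁ :=
    hC.closedBall_subset.trans (subset_union_left.trans hC.subset_closedBall)
  have hr₁ : 0 < r₁ := by
    have : (ρ : ℂ) ∈ closedBall (0 : ℂ) ρ := by simp [abs_of_pos hC.pos]
    have := hρ this
    rw [mem_closedBall_zero_iff, norm_real, Real.norm_of_nonneg hC.pos.le] at this
    exact hC.pos.trans_le this
  have hMr : M < 1 / r₁ ^ n := by
    have h1 : r₁ ^ n < r₀ ^ n := pow_lt_pow_left₀ hr hr₁.le h.n_pos.ne'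
    rw [lt_div_iff₀ (by positivity), ← h.radius_pow, mul_comm]
    exact mul_lt_mul_of_pos_right h1 h.M_pos
  -- The first set covers the lemniscate's inside and some exterior points missed by the image; it
  -- overlaps the second, so openness across the level `M` needs no information on `ω` there.
  have : (ψ '' ((O ∪ C) \ {0}))ᶜ = {z | ∏ i, ‖z - w i‖ < 1 / r₁ ^ n} ∪
      ({z | M < ∏ i, ‖z - w i‖} ∩ ω ⁻¹' (O ∪ C)ᶜ) := by
    ext z
    rw [mem_compl_iff, h.mem_image_iff (hC.sdiff_subset hr)]
    constructor
    · intro hz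
      rcases le_or_gt (∏ i, ‖z - w i‖) M with h1 | h1
      · exact Or.inl (h1.trans_lt hMr)
      · exact Or.inr ⟨h1, fun h2 => hz ⟨h1, h2, (h.left_inv z h1).1.2⟩⟩
    · rintro (h1 | h1) ⟨h2, h3⟩
      · have h4 := (h.right_inv _ (h.left_inv z h2).1).2
        rw [(h.left_inv z h2).2] at h4
        have h5 : ‖ω z‖ ≤ r₁ := mem_closedBall_zero_iff.1 (hC.subset_closedBall h3.1)
        have h6 : ‖ω z‖ ^ n ≤ r₁ ^ n := pow_le_pow_left₀ (norm_nonneg _) h5 n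
        rw [mem_ofPred_eq, lt_div_iff₀ (by positivity)] at h1
        have h7 := mul_le_mul_of_nonneg_right h6 (h.M_pos.trans h2).le
        linarith
      · exact h1.2 h3.1
  rw [this]
  exact (isOpen_lt (by fun_prop) continuous_const).union
    (h.continuousOn.isOpen_inter_preimage (isOpen_exterior w M) hC.isClosed.isOpen_compl)

theorem prod_lt_of_mem_compl_image (h : IsExteriorCoordinate w M r₀ ω ψ)
    (hC : IsAnnularCurve O C ρ r₁) (hr : r₁ < r₀) {z : ℂ} (hz : z ∉ ψ '' (O \ {0})) :
    ∏ i, ‖z - w i‖ < 1 / ρ ^ n := by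
  have hρ := hC.pos
  rw [h.mem_image_iff (hC.open_sdiff_subset.trans (hC.sdiff_subset hr))] at hz
  by_contra! hcon
  have hρr : ρ < r₀ := by
    have : (ρ : ℂ) ∈ closedBall (0 : ℂ) ρ := by simp [abs_of_pos hC.pos]
    have := hC.subset_closedBall (Or.inl (hC.closedBall_subset this))
    rw [mem_closedBall_zero_iff, norm_real, Real.norm_of_nonneg hC.pos.le] at this
    exact this.trans_lt hr
  have hM : M < ∏ i, ‖z - w i‖ := by
    refine lt_of_lt_of_le ?_ hcon
    have h1 : ρ ^ n < r₀ ^ n := pow_lt_pow_left₀ hρr hρ.le h.n_pos.ne'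
    rw [lt_div_iff₀ (by positivity), ← h.radius_pow, mul_comm]
    exact mul_lt_mul_of_pos_right h1 h.M_pos
  refine hz ⟨hM, hC.closedBall_subset ?_, (h.left_inv z hM).1.2⟩
  rw [mem_closedBall_zero_iff]
  have h4 := (h.right_inv _ (h.left_inv z hM).1).2
  rw [(h.left_inv z hM).2] at h4
  refine le_of_pow_le_pow_left₀ h.n_pos.ne' hρ.le ?_
  rw [div_le_iff₀ (by positivity)] at hcon
  have hq := h.M_pos.trans hM
  refine le_of_mul_le_mul_right ?_ hq
  linarith

theorem isBounded_compl_image (h : IsExteriorCoordinate w M r₀ ω ψ) (hC : IsAnnularCurve O C ρ r₁)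
    (hr : r₁ < r₀) : Bornology.IsBounded (ψ '' ((O ∪ C) \ {0}))ᶜ :=
  (isBounded_prod_norm_le h.n_pos w (1 / ρ ^ n)).subset fun _ hz =>
    (h.prod_lt_of_mem_compl_image hC hr fun hz' => hz (image_mono hC.open_sdiff_subset hz')).le

theorem not_isBounded_image (h : IsExteriorCoordinate w M r₀ ω ψ) (hC : IsAnnularCurve O C ρ r₁)
    (hr : r₁ < r₀) : ¬ Bornology.IsBounded (ψ '' (O \ {0})) := by
  intro hb
  have hq : Continuous fun z => ∏ i, ‖z - w i‖ := by fun_prop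
  obtain ⟨T, hT⟩ := (hb.isCompact_closure.image hq).isBounded.bddAbove
  have hT' : ∀ y ∈ O \ {0}, ∏ i, ‖ψ y - w i‖ ≤ T := fun y hy =>
    hT ⟨ψ y, subset_closure ⟨y, hy, rfl⟩, rfl⟩
  have hρ := hC.pos
  -- As `y → 0`, the relation `‖y‖ ^ n * ∏ i, ‖ψ y - w i‖ = 1` makes the product unbounded; `e` is
  -- small enough to exceed the supposed bound `T`.
  obtain ⟨e, he0, heρ, he1, heT⟩ : ∃ e : ℝ, 0 < e ∧ e ≤ ρ ∧ e ≤ 1 ∧ e * (|T| + 1) ≤ 1 := by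
    refine ⟨min ρ (1 / (|T| + 1)), lt_min hρ (by positivity), min_le_left _ _, ?_, ?_⟩
    · exact (min_le_right _ _).trans ((div_le_one (by positivity)).2 (by linarith [abs_nonneg T]))
    · rw [← le_div_iff₀ (by positivity)]
      exact min_le_right _ _
  have hen : ‖(e : ℂ)‖ = e := by rw [norm_real, Real.norm_of_nonneg he0.le]
  have heO : (e : ℂ) ∈ O \ {0} :=
    ⟨hC.closedBall_subset (by rw [mem_closedBall_zero_iff, hen]; exact heρ), by
      simpa using he0.ne'⟩
  have h1 := hT' _ heO
  have h2 := (h.right_inv _ (hC.sdiff_subset hr (hC.open_sdiff_subset heO))).2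
  rw [hen] at h2
  have h3 : e ^ n ≤ e := pow_le_of_le_one he0.le he1 h.n_pos.ne'
  have h4 : 0 ≤ ∏ i, ‖ψ e - w i‖ := by positivity
  have h5 : 1 ≤ e * ∏ i, ‖ψ e - w i‖ := by
    rw [← h2]
    gcongr
  have h6 : e * ∏ i, ‖ψ e - w i‖ ≤ e * |T| := by
    gcongr
    exact h1.trans (le_abs_self T)
  linarith

theorem isPreconnected_image (h : IsExteriorCoordinate w M r₀ ω ψ) (hC : IsAnnularCurve O C ρ r₁)
    (hr : r₁ < r₀) : IsPreconnected (ψ '' (O \ {0})) :=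
  hC.preconnected.image _ (h.differentiableOn.continuousOn.mono
    (hC.open_sdiff_subset.trans (hC.sdiff_subset hr)))

theorem compl_image_eq (h : IsExteriorCoordinate w M r₀ ω ψ) (hC : IsAnnularCurve O C ρ r₁)
    (hr : r₁ < r₀) : (ψ '' C)ᶜ = (ψ '' ((O ∪ C) \ {0}))ᶜ ∪ ψ '' (O \ {0}) := by
  ext z
  rw [mem_union, mem_compl_iff, mem_compl_iff, h.mem_image_iff (hC.sdiff_subset hr),
    h.mem_image_iff (hC.curve_subset_sdiff.trans (hC.sdiff_subset hr)),
    h.mem_image_iff (hC.open_sdiff_subset.trans (hC.sdiff_subset hr))]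
  have h0 := hC.zero_notMem
  have hd : ω z ∈ O → ω z ∉ C := fun h1 h2 => hC.disjoint.le_bot ⟨h1, h2⟩
  have h1 : ω z = 0 → ω z ∉ C := fun h h' => h0 (h ▸ h')
  simp only [Set.mem_sdiff, mem_union, mem_singleton_iff]
  tauto

theorem disjoint_images (hC : IsAnnularCurve O C ρ r₁) :
    Disjoint (ψ '' ((O ∪ C) \ {0}))ᶜ (ψ '' (O \ {0})) :=
  disjoint_compl_left_iff_subset.2 (image_mono hC.open_sdiff_subset)

/-- The complement of the curve splits into two disjoint open pieces, one bounded and the other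
connected and unbounded. Connectedness of the bounded piece is not needed. -/
theorem isBounded_connectedComponentIn_iff (h : IsExteriorCoordinate w M r₀ ω ψ)
    (hC : IsAnnularCurve O C ρ r₁) (hr : r₁ < r₀) {z : ℂ} (hz : z ∉ ψ '' C) :
    Bornology.IsBounded (connectedComponentIn (ψ '' C)ᶜ z) ↔ z ∉ ψ '' (O \ {0}) := by
  constructor
  · intro hb hz'
    refine h.not_isBounded_image hC hr (hb.subset ?_)
    refine (h.isPreconnected_image hC hr).subset_connectedComponentIn hz' ?_
    rw [h.compl_image_eq hC hr]
    exact subset_union_right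
  · intro hz'
    refine (h.isBounded_compl_image hC hr).subset ?_
    refine isPreconnected_connectedComponentIn.subset_left_of_subset_union
      (h.isOpen_compl_image hC hr) (h.isOpen_image hC hr) (disjoint_images hC)
      ((connectedComponentIn_subset _ _).trans (h.compl_image_eq hC hr).subset)
      ⟨z, mem_connectedComponentIn hz, ?_⟩
    have : z ∈ (ψ '' C)ᶜ := hz
    rw [h.compl_image_eq hC hr] at this
    exact this.resolve_right hz'

theorem inner_eq (h : IsExteriorCoordinate w M r₀ ω ψ) (hC : IsAnnularCurve O C ρ r₁)
    (hr : r₁ < r₀) : inner (ψ '' C) = (ψ '' ((O ∪ C) \ {0}))ᶜ := by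
  ext z
  have h1 := Set.ext_iff.1 (h.compl_image_eq hC hr) z
  have h2 := (disjoint_images (ψ := ψ) hC).notMem_of_mem_left (a := z)
  constructor
  · rintro ⟨hz, hb⟩
    rw [h.isBounded_connectedComponentIn_iff hC hr hz] at hb
    exact (h1.1 hz).resolve_right hb
  · intro hz
    have hzC := h1.2 (Or.inl hz)
    exact ⟨hzC, (h.isBounded_connectedComponentIn_iff hC hr hzC).2 (h2 hz)⟩

theorem outer_eq (h : IsExteriorCoordinate w M r₀ ω ψ) (hC : IsAnnularCurve O C ρ r₁)
    (hr : r₁ < r₀) :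
    outer (ψ '' C) = insert ∞ ((fun z : ℂ => (z : OnePoint ℂ)) '' (ψ '' (O \ {0}))) := by
  rw [outer]
  congr 2
  ext z
  have h1 := Set.ext_iff.1 (h.compl_image_eq hC hr) z
  constructor
  · rintro ⟨hz, hb⟩
    rwa [h.isBounded_connectedComponentIn_iff hC hr hz, not_not] at hb
  · intro hz
    have hzC := h1.2 (Or.inr hz)
    refine ⟨hzC, ?_⟩
    rwa [h.isBounded_connectedComponentIn_iff hC hr hzC, not_not]

theorem isJordanCurve_image (h : IsExteriorCoordinate w M r₀ ω ψ) (hC : IsAnnularCurve O C ρ r₁)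
    (hr : r₁ < r₀) : IsJordanCurve (ψ '' C) := by
  obtain ⟨γ, hγ, hinj, hrange⟩ := hC.jordan
  have hmem : ∀ t, γ t ∈ ball (0 : ℂ) r₀ \ {0} := fun t =>
    hC.sdiff_subset hr (hC.curve_subset_sdiff (hrange ▸ mem_range_self t))
  refine ⟨fun t => ψ (γ t), ?_, fun s t hst => hinj (h.injOn (hmem s) (hmem t) hst), ?_⟩
  · exact h.differentiableOn.continuousOn.comp_continuous hγ hmem
  · rw [← hrange, ← range_comp]
    rfl

end IsExteriorCoordinate

/-- Annular curves in a suitable exterior coordinate are close to a given arc-like continuum. -/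
theorem exists_exteriorCoordinate_close {K : Set ℂ} (hK : IsCompact K) (hconn : IsConnected K)
    (hinf : K.Infinite) (hcompl : IsPreconnected Kᶜ) (hint : interior K = ∅) {ε : ℝ} (hε : 0 < ε) :
    ∃ (n : ℕ) (w : Fin n → ℂ) (M r₀ : ℝ) (ω ψ : ℂ → ℂ) (ρ : ℝ), ρ < r₀ ∧ 0 < ρ ∧
      IsExteriorCoordinate w M r₀ ω ψ ∧ ∀ O C r₁, IsAnnularCurve O C ρ r₁ → r₁ < r₀ →
        (∀ z ∈ ψ '' C, ∃ k ∈ K, dist z k < ε) ∧ ∀ k ∈ K, ∃ z ∈ ψ '' C, dist k z < ε := by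
  obtain ⟨δ', hδ', hfar⟩ := exists_uniform_far_points hK hconn.nonempty hint hε
  set δ := min δ' ε with hδdef
  have hδ : 0 < δ := lt_min hδ' hε
  obtain ⟨n, w, M₁, hn, hw, hM₁, hle, hlt⟩ :=
    exists_norm_prod_gt_of_compl_preconnected hK hinf hcompl hδ
  have hq : Continuous fun z => ∏ i, ‖z - w i‖ := by fun_prop
  -- A compactness argument opens a gap above `M₁`, leaving room for the level `M` of the
  -- coordinate.
  obtain ⟨M₂, hM₂, hM₂'⟩ : ∃ M₂ > M₁, ∀ z, δ ≤ infDist z K → M₂ ≤ ∏ i, ‖z - w i‖ := by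
    set F : Set ℂ := {z | δ ≤ infDist z K ∧ ∏ i, ‖z - w i‖ ≤ M₁ + 1} with hF
    have hFc : IsCompact F := by
      refine Metric.isCompact_of_isClosed_isBounded ?_
        ((isBounded_prod_norm_le hn w (M₁ + 1)).subset fun z hz => hz.2)
      exact (isClosed_le continuous_const (continuous_infDist_pt K)).inter
        (isClosed_le hq continuous_const)
    rcases F.eq_empty_or_nonempty with hFe | hFne
    · refine ⟨M₁ + 1, by linarith, fun z hz => ?_⟩
      by_contra! hcon
      exact (hFe ▸ (⟨hz, hcon.le⟩ : z ∈ F) : z ∈ (∅ : Set ℂ))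
    · obtain ⟨z₀, hz₀, hmin⟩ := hFc.exists_isMinOn hFne hq.continuousOn
      refine ⟨∏ i, ‖z₀ - w i‖, hlt z₀ hz₀.1, fun z hz => ?_⟩
      rcases le_or_gt (∏ i, ‖z - w i‖) (M₁ + 1) with h1 | h1
      · exact hmin (⟨hz, h1⟩ : z ∈ F)
      · exact hz₀.2.trans h1.le
  obtain ⟨M, hM₁M, hMM₂⟩ := exists_between hM₂
  have hM : 0 < M := hM₁.trans hM₁M
  obtain ⟨r₀, ω, ψ, hr₀, hpow, hωc, hψd, hl, hri⟩ := exists_exterior_coordinate hK hconn hn hw hM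
    (fun z hz => (hle z hz).trans_lt hM₁M)
  have h : IsExteriorCoordinate w M r₀ ω ψ := ⟨hn, hM, hr₀, hpow, hωc, hψd, hl, hri⟩
  have hM₂0 : 0 < M₂ := hM₁.trans hM₂
  -- A curve enclosing the disc of radius `M₂^(-1/n)` has image in `{∏ i, ‖z - w i‖ < M₂}`, hence
  -- within `δ` of `K`.
  set ρ : ℝ := (1 / M₂) ^ ((n : ℝ)⁻¹) with hρdef
  have hρ : 0 < ρ := by positivity
  have hρn : ρ ^ n = 1 / M₂ := Real.rpow_inv_natCast_pow (by positivity) hn.ne'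
  have hρr : ρ < r₀ := by
    refine lt_of_pow_lt_pow_left₀ n hr₀.le ?_
    rw [hρn, eq_div_of_mul_eq hM.ne' hpow]
    exact one_div_lt_one_div_of_lt hM hMM₂
  refine ⟨n, w, M, r₀, ω, ψ, ρ, hρr, hρ, h, fun O C r₁ hC hr => ⟨?_, ?_⟩⟩
  · intro z hz
    have hz' : z ∉ ψ '' (O \ {0}) := fun hz' => by
      have : z ∈ (ψ '' C)ᶜ := by
        rw [h.compl_image_eq hC hr]
        exact Or.inr hz'
      exact this hz
    have h1 := h.prod_lt_of_mem_compl_image hC hr hz'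
    rw [hρn, one_div_one_div] at h1
    have h2 : infDist z K < δ := by
      by_contra! hcon
      exact absurd (hM₂' z hcon) (not_le.2 h1)
    exact (infDist_lt_iff hconn.nonempty).1 (h2.trans_le (min_le_right _ _))
  · intro k hk
    obtain ⟨d, hkd, hd⟩ := hfar k hk
    have hdO : d ∈ ψ '' (O \ {0}) := by
      by_contra hcon
      have h1 := h.prod_lt_of_mem_compl_image hC hr hcon
      rw [hρn, one_div_one_div] at h1
      exact absurd (hM₂' d ((min_le_left _ _).trans hd)) (not_le.2 h1)
    have hkI : k ∈ (ψ '' ((O ∪ C) \ {0}))ᶜ := fun hcon => by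
      have := ((h.mem_image_iff (hC.sdiff_subset hr)).1 hcon).1
      exact absurd (hle k hk) (not_le.2 (hM₁M.trans this))
    by_contra! hcon
    -- A segment avoiding the curve would join `k`, in the bounded piece, to `d`, in the unbounded
    -- one.
    have hseg : segment ℝ k d ⊆ (ψ '' C)ᶜ := by
      intro z hz hzC
      have h1 := hcon z hzC
      have h2 := dist_add_dist_of_mem_segment hz
      linarith [dist_nonneg (x := z) (y := d)]
    rw [h.compl_image_eq hC hr] at hseg
    have h3 := (convex_segment k d).isPreconnected.subset_left_of_subset_union
      (h.isOpen_compl_image hC hr) (h.isOpen_image hC hr) (IsExteriorCoordinate.disjoint_images hC) hseg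
      ⟨k, left_mem_segment ℝ k d, hkI⟩
    exact h3 (right_mem_segment ℝ k d) (image_mono hC.open_sdiff_subset hdO)

end MatchingProblem

/-! ### Lemniscates are MP-solvable -/

namespace MatchingProblem

open Set Metric Filter Topology Complex
open scoped OnePoint

/-- A small punctured disc about `a` is connected, so it lies on one side of any separation of `U \
{a}`; filling in the disc on that side would separate `U`. -/
theorem isPreconnected_sdiff_singleton {U : Set ℂ} (hU : IsOpen U) (hc : IsPreconnected U) {a : ℂ}
    (ha : a ∈ U) : IsPreconnected (U \ {a}) := by
  obtain ⟨r, hr, hball⟩ := Metric.isOpen_iff.1 hU a ha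
  set D : Set ℂ := ball a r \ {a} with hD
  have hDc : IsPreconnected D := by
    have : D = (fun p : ℝ × ℝ => circleMap a p.1 p.2) '' (Ioo 0 r ×ˢ univ) := by
      ext z
      simp only [hD, Set.mem_sdiff, mem_ball, dist_eq_norm, mem_singleton_iff, mem_image, mem_prod,
        mem_Ioo, mem_univ, and_true, Prod.exists]
      constructor
      · rintro ⟨h1, h2⟩
        exact ⟨‖z - a‖, (z - a).arg, ⟨norm_pos_iff.2 (sub_ne_zero.2 h2), h1⟩, by
          simp [circleMap, norm_mul_exp_arg_mul_I]⟩
      · rintro ⟨s, θ, ⟨h1, h2⟩, rfl⟩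
        exact ⟨by simpa [circleMap, abs_of_pos h1] using h2, by
          simp [circleMap, h1.ne']⟩
    rw [this]
    refine (isPreconnected_Ioo.prod isPreconnected_univ).image _ ?_
    unfold circleMap
    fun_prop
  have hDU : D ⊆ U \ {a} := sdiff_subset_sdiff_left hball
  have key : ∀ u v : Set ℂ, IsOpen u → IsOpen v → U \ {a} ⊆ u ∪ v → D ⊆ u →
      ((U \ {a}) ∩ v).Nonempty → ((U \ {a}) ∩ (u ∩ v)).Nonempty := by
    rintro u v hu hv huv hDu ⟨y, hy, hyv⟩
    obtain ⟨x, hxU, hx1, hx2, hxa⟩ := hc (u ∪ ball a r) (v ∩ {a}ᶜ) (hu.union isOpen_ball)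
      (hv.inter isOpen_compl_singleton) (fun x hx => by
        rcases eq_or_ne x a with rfl | hxa
        · exact Or.inl (Or.inr (mem_ball_self hr))
        · exact (huv ⟨hx, hxa⟩).imp Or.inl fun h => ⟨h, hxa⟩)
      ⟨a, ha, Or.inr (mem_ball_self hr)⟩ ⟨y, hy.1, hyv, hy.2⟩
    exact ⟨x, ⟨hxU, hxa⟩, hx1.elim id fun h => hDu ⟨h, hxa⟩, hx2⟩
  rintro u v hu hv huv hnu hnv
  by_contra hcon
  rcases isPreconnected_iff_subset_of_disjoint.1 hDc u v hu hv (hDU.trans huv)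
    (by
      rw [eq_empty_iff_forall_notMem]
      exact fun x hx => hcon ⟨x, hDU hx.1, hx.2⟩) with h | h
  · exact hcon (key u v hu hv huv h hnv)
  · rw [inter_comm u v] at hcon
    exact hcon (key v u hv hu (union_comm u v ▸ huv) h hnu)

theorem isJordanCurve_sphere {r : ℝ} (hr : 0 < r) : IsJordanCurve (sphere (0 : ℂ) r) := by
  have hr' : (r : ℂ) ≠ 0 := by exact_mod_cast hr.ne'
  refine ⟨fun t => r * t, by fun_prop, fun s t hst => ?_, ?_⟩
  · exact Subtype.ext (mul_left_cancel₀ hr' hst)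
  · ext z
    simp only [mem_range, mem_sphere_iff_norm, sub_zero]
    constructor
    · rintro ⟨t, rfl⟩
      rw [norm_mul, Circle.norm_coe, norm_real, Real.norm_of_nonneg hr.le, mul_one]
    · intro hz
      refine ⟨⟨z / r, ?_⟩, ?_⟩
      · exact mem_sphere_zero_iff_norm.2 (by simp [hz, abs_of_pos hr, hr.ne'])
      · simp only
        field_simp

theorem isAnnularCurve_sphere {ρ r : ℝ} (hρ : 0 < ρ) (hr : ρ < r) :
    IsAnnularCurve (ball 0 r) (sphere 0 r) ρ r where
  isOpen := isOpen_ball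
  pos := hρ
  closedBall_subset := closedBall_subset_ball hr
  jordan := isJordanCurve_sphere (hρ.trans hr)
  subset_closedBall := by rw [ball_union_sphere]
  isClosed := by
    rw [ball_union_sphere]
    exact isClosed_closedBall
  disjoint := sphere_disjoint_ball.symm
  preconnected := isPreconnected_sdiff_singleton isOpen_ball isPreconnected_ball
    (mem_ball_self (hρ.trans hr))

/-- The scaling by `r ^ n` makes `f` unimodular on the curve, where its inverse and its conjugate
therefore coincide. -/
theorem isMPSolvable_image_sphere {n : ℕ} {w : Fin n → ℂ} {M r₀ : ℝ} {ω ψ : ℂ → ℂ}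
    (h : IsExteriorCoordinate w M r₀ ω ψ) {r : ℝ} (hr0 : 0 < r) (hr : r < r₀) :
    IsMPSolvable (ψ '' sphere 0 r) := by
  have hC := isAnnularCurve_sphere (half_pos hr0) (half_lt_self hr0)
  have hinner := h.inner_eq hC hr
  have houter := h.outer_eq hC hr
  have hn := h.n_pos
  set f : ℂ → ℂ := fun z => r ^ n * ∏ i, (z - w i) with hf
  have hfd : Differentiable ℂ f := by fun_prop
  have hfn : ∀ z, ‖f z‖ = r ^ n * ∏ i, ‖z - w i‖ := fun z => by
    rw [hf, norm_mul, norm_pow, norm_prod, norm_real, Real.norm_of_nonneg hr0.le]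
  have hU : ∀ z, M < ∏ i, ‖z - w i‖ → f z ≠ 0 := by
    intro z hz
    rw [← norm_ne_zero_iff, hfn]
    have := h.M_pos.trans hz
    positivity
  set g : OnePoint ℂ → ℂ := fun x => x.elim 0 (fun z => (f z)⁻¹) with hg
  have hg0 : g ∞ = 0 := rfl
  have hgz : ∀ z : ℂ, g z = (f z)⁻¹ := fun z => rfl
  have hO : ∀ z : ℂ, (z : OnePoint ℂ) ∈ outer (ψ '' sphere 0 r) ↔ z ∈ ψ '' (ball 0 r \ {0}) := by
    intro z
    rw [houter]
    simp
  have hOU : ∀ z : ℂ, (z : OnePoint ℂ) ∈ outer (ψ '' sphere 0 r) → f z ≠ 0 := fun z hz =>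
    hU z ((h.mem_image_iff (hC.open_sdiff_subset.trans (hC.sdiff_subset hr))).1 ((hO z).1 hz)).1
  refine ⟨f, g, ⟨hfd.continuous.continuousOn, hfd.differentiableOn⟩, ?_, ⟨?_, ⟨?_, ?_⟩, hg0⟩, ?_, ?_⟩
  -- With `r < s < r₀` the point `ψ s` is inside the curve but outside the lemniscate of level `M`,
  -- so `f` is nonzero there; it vanishes at the node.
  · obtain ⟨s, hs1, hs2⟩ := exists_between hr
    have hs0 : 0 < s := hr0.trans hs1
    have hsn : ‖(s : ℂ)‖ = s := by rw [norm_real, Real.norm_of_nonneg hs0.le]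
    have hsb : (s : ℂ) ∈ ball (0 : ℂ) r₀ \ {0} := by
      refine ⟨?_, by simpa using hs0.ne'⟩
      rw [mem_ball_zero_iff, hsn]
      exact hs2
    refine ⟨w ⟨0, hn⟩, subset_closure ?_, ψ s, subset_closure ?_, ?_⟩
    · rw [hinner, mem_compl_iff, h.mem_image_iff (hC.sdiff_subset hr)]
      rintro ⟨h1, -⟩
      rw [Finset.prod_eq_zero (Finset.mem_univ ⟨0, hn⟩) (by simp)] at h1
      exact absurd h.M_pos (not_lt.2 h1.le)
    · rw [hinner, mem_compl_iff, h.mem_image_iff (hC.sdiff_subset hr), (h.right_inv _ hsb).1]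
      rintro ⟨-, h1, -⟩
      have := hC.subset_closedBall h1
      rw [mem_closedBall_zero_iff, hsn] at this
      linarith
    · have h1 : f (w ⟨0, hn⟩) = 0 := by
        simp only [hf]
        rw [Finset.prod_eq_zero (Finset.mem_univ ⟨0, hn⟩) (by simp), mul_zero]
      rw [h1]
      exact (hU _ (h.lt_prod hsb)).symm
  · intro x hx
    refine ContinuousAt.continuousWithinAt ?_
    induction x with
    | infty =>
      rw [OnePoint.continuousAt_infty', hg0, coclosedCompact_eq_cocompact,
        ← Metric.cobounded_eq_cocompact]
      have hlim : Tendsto f (Bornology.cobounded ℂ) (Bornology.cobounded ℂ) := by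
        rw [← tendsto_norm_atTop_iff_cobounded, Filter.tendsto_atTop]
        intro T
        filter_upwards [Bornology.isBounded_def.1 (isBounded_prod_norm_le hn w (T / r ^ n))]
          with z hz
        rw [mem_compl_iff, mem_ofPred_eq, not_le, div_lt_iff₀ (by positivity)] at hz
        rw [hfn]
        linarith
      exact (tendsto_inv₀_cobounded.comp hlim)
    | coe z =>
      rw [OnePoint.continuousAt_coe]
      -- The zeros of `f` lie in the open inner set, which misses the closure of the outer one.
      have hzU : f z ≠ 0 := by
        by_contra hz0
        have hI : IsOpen ((fun z : ℂ => (z : OnePoint ℂ)) '' inner (ψ '' sphere 0 r)) := by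
          rw [OnePoint.isOpen_image_coe, hinner]
          exact h.isOpen_compl_image hC hr
        have hzI : z ∈ inner (ψ '' sphere 0 r) := by
          rw [hinner, mem_compl_iff, h.mem_image_iff (hC.sdiff_subset hr)]
          rintro ⟨h1, -⟩
          exact hU z h1 hz0
        obtain ⟨y, ⟨v, hv, rfl⟩, hy⟩ := mem_closure_iff.1 hx _ hI ⟨z, hzI, rfl⟩
        rw [hinner] at hv
        exact hv (image_mono hC.open_sdiff_subset ((hO v).1 hy))
      exact hfd.continuous.continuousAt.inv₀ hzU
  · intro z hz
    exact ((hfd z).inv (hOU z hz)).differentiableWithinAt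
  -- `F v = v ^ n * f v⁻¹` is a polynomial with `F 0 = r ^ n ≠ 0`, so `g = v ^ n / F v` is
  -- holomorphic at infinity.
  · set F : ℂ → ℂ := fun v => r ^ n * ∏ i, (1 - v * w i) with hF
    have hFd : Differentiable ℂ F := by fun_prop
    have hFf : ∀ v ≠ 0, f v⁻¹ * v ^ n = F v := by
      intro v hv
      have h1 : ∀ i, 1 - v * w i = (v⁻¹ - w i) * v := fun i => by
        field_simp
      simp only [hF, hf, h1, Finset.prod_mul_distrib, Finset.prod_const, Finset.card_univ,
        Fintype.card_fin, mul_assoc]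
    have hgF : (fun v => g (invChart v)) = fun v => v ^ n / F v := by
      funext v
      rcases eq_or_ne v 0 with rfl | hv
      · simp [invChart, hg0, hn.ne']
      · have hvn : v ^ n ≠ 0 := pow_ne_zero n hv
        rw [invChart, if_neg hv, hgz, ← hFf v hv]
        rcases eq_or_ne (f v⁻¹) 0 with h0 | h0
        · simp [h0]
        · field_simp
    rw [hgF]
    intro v hv
    refine DifferentiableAt.differentiableWithinAt ?_
    refine DifferentiableAt.div (by fun_prop) (hFd v) ?_
    rcases eq_or_ne v 0 with rfl | hv0
    · simp [hF, hr0.ne']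
    · rw [← hFf v hv0]
      rw [mem_ofPred_eq, invChart, if_neg hv0] at hv
      exact mul_ne_zero (hOU _ hv) (pow_ne_zero n hv0)
  · have hsn : ‖((r / 2 : ℝ) : ℂ)‖ = r / 2 := by rw [norm_real, Real.norm_of_nonneg (by positivity)]
    have hs : ((r / 2 : ℝ) : ℂ) ∈ ball (0 : ℂ) r \ {0} := by
      refine ⟨?_, fun h0 => ?_⟩
      · rw [mem_ball_zero_iff, hsn]
        linarith
      · rw [mem_singleton_iff] at h0
        rw [h0, norm_zero] at hsn
        linarith
    have hmem : ((ψ (r / 2 : ℝ) : ℂ) : OnePoint ℂ) ∈ outer (ψ '' sphere 0 r) :=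
      (hO _).2 ⟨_, hs, rfl⟩
    refine ⟨∞, subset_closure ?_, (ψ (r / 2 : ℝ) : ℂ), subset_closure hmem, ?_⟩
    · rw [houter]
      exact mem_insert _ _
    · rw [hg0, hgz]
      exact (inv_ne_zero (hOU _ hmem)).symm
  · rintro _ ⟨y, hy, rfl⟩
    have hyb := hC.sdiff_subset hr (hC.curve_subset_sdiff hy)
    have h1 : ‖f (ψ y)‖ = 1 := by
      rw [hfn, ← (h.right_inv y hyb).2, mem_sphere_zero_iff_norm.1 hy]
    rw [hgz, inv_eq_conj h1, conj_conj]

end MatchingProblem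

/-! ### Rigidity: matching on two parallel half-lines forces a period -/

namespace MatchingProblem

open Set Metric Filter Topology Complex
open scoped ComplexConjugate

/-- A function holomorphic in a square and vanishing on one of its sides vanishes. -/
theorem eventually_eq_zero_of_square_side {d : ℂ → ℂ} {c : ℂ}
    (hc : ContinuousOn d {z | |(z - c).re| ≤ 1 ∧ |(z - c).im| ≤ 1})
    (hd : DifferentiableOn ℂ d {z | |(z - c).re| < 1 ∧ |(z - c).im| < 1})
    (h0 : ∀ z, |(z - c).re| ≤ 1 → (z - c).im = 1 → d z = 0) : ∀ᶠ z in 𝓝 c, d z = 0 := by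
  set Q : Set ℂ := {z | |(z - c).re| < 1 ∧ |(z - c).im| < 1} with hQ
  set Q' : Set ℂ := {z | |(z - c).re| ≤ 1 ∧ |(z - c).im| ≤ 1} with hQ'
  have hre : Continuous fun z : ℂ => |(z - c).re| := by fun_prop
  have him : Continuous fun z : ℂ => |(z - c).im| := by fun_prop
  have hQo : IsOpen Q := (isOpen_lt hre continuous_const).inter (isOpen_lt him continuous_const)
  have hQ'c : IsClosed Q' :=
    (isClosed_le hre continuous_const).inter (isClosed_le him continuous_const)
  have hQQ' : Q ⊆ Q' := fun z hz => ⟨hz.1.le, hz.2.le⟩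
  have hcl : closure Q ⊆ Q' := closure_minimal hQQ' hQ'c
  have hb : Bornology.IsBounded Q := by
    refine isBounded_closedBall.subset (t := closedBall c 2) fun z hz => ?_
    rw [mem_closedBall, dist_eq_norm]
    linarith [norm_le_abs_re_add_abs_im (z - c), hz.1, hz.2]
  -- Quarter turns about `c`. Every boundary point is turned onto the side where `d` vanishes by one
  -- of the four, so the product `H` is zero on the boundary and hence inside; isolated zeros of `d`
  -- would forbid this.
  set ρ : ℕ → ℂ → ℂ := fun k z => c + I ^ k * (z - c) with hρ
  have hρQ : ∀ k z, z ∈ Q → ρ k z ∈ Q := by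
    intro k
    induction k with
    | zero => intro z hz; simpa [hρ] using hz
    | succ k ih =>
      intro z hz
      have := ih z hz
      simp only [hρ, hQ, mem_ofPred_eq, add_sub_cancel_left, pow_succ', mul_assoc, I_mul_re,
        I_mul_im, abs_neg] at this ⊢
      exact ⟨this.2, this.1⟩
  have hρQ' : ∀ k z, z ∈ Q' → ρ k z ∈ Q' := by
    intro k
    induction k with
    | zero => intro z hz; simpa [hρ] using hz
    | succ k ih =>
      intro z hz
      have := ih z hz
      simp only [hρ, hQ', mem_ofPred_eq, add_sub_cancel_left, pow_succ', mul_assoc, I_mul_re,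
        I_mul_im, abs_neg] at this ⊢
      exact ⟨this.2, this.1⟩
  have hρd : ∀ k, Differentiable ℂ (ρ k) := fun k => by fun_prop
  have hdk : ∀ k, DifferentiableOn ℂ (fun z => d (ρ k z)) Q := fun k =>
    hd.comp (hρd k).differentiableOn (hρQ k)
  set H : ℂ → ℂ := fun z => ∏ k ∈ Finset.range 4, d (ρ k z) with hH
  have hHd : DiffContOnCl ℂ H Q := by
    refine ⟨DifferentiableOn.fun_finsetProd fun k _ => hdk k, ?_⟩
    refine continuousOn_finsetProd _ fun k _ => ?_
    exact (hc.comp (hρd k).continuous.continuousOn (hρQ' k)).mono hcl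
  have hHfr : ∀ z ∈ frontier Q, ‖H z‖ ≤ 0 := by
    intro z hz
    have hz' : z ∈ Q' := hcl (frontier_subset_closure hz)
    have hzQ : z ∉ Q := by
      rw [hQo.frontier_eq] at hz
      exact hz.2
    have hk : ∃ k ∈ Finset.range 4, (ρ k z - c).im = 1 := by
      simp only [hρ, add_sub_cancel_left]
      by_contra! hcon
      have e0 := hcon 0 (by simp)
      have e1 := hcon 1 (by simp)
      have e2 := hcon 2 (by simp)
      have e3 := hcon 3 (by simp)
      rw [pow_zero, one_mul] at e0
      rw [pow_one, I_mul_im] at e1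
      rw [I_sq, neg_one_mul, neg_im] at e2
      rw [I_pow_three, neg_mul, neg_im, I_mul_im] at e3
      have hre := abs_le.1 hz'.1
      have him := abs_le.1 hz'.2
      exact hzQ ⟨abs_lt.2 ⟨lt_of_le_of_ne hre.1 fun h => e3 (by linarith), lt_of_le_of_ne hre.2 e1⟩,
        abs_lt.2 ⟨lt_of_le_of_ne him.1 fun h => e2 (by linarith), lt_of_le_of_ne him.2 e0⟩⟩
    obtain ⟨k, hk4, hk⟩ := hk
    rw [norm_le_zero_iff, hH]
    exact Finset.prod_eq_zero hk4 (h0 _ (hρQ' k z hz').1 hk)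
  have hH0 : ∀ z ∈ Q, H z = 0 := fun z hz => by
    simpa using norm_le_of_forall_mem_frontier_norm_le hb hHd hHfr (subset_closure hz)
  have hcQ : c ∈ Q := by simp [hQ]
  have hρc : ∀ k, ρ k c = c := fun k => by simp [hρ]
  refine ((hd.analyticAt (hQo.mem_nhds hcQ)).eventually_eq_zero_or_eventually_ne_zero).resolve_right
    fun hne => ?_
  have hall : ∀ᶠ z in 𝓝[≠] c, ∀ k ∈ Finset.range 4, d (ρ k z) ≠ 0 := by
    rw [Filter.eventually_all_finset]
    intro k _
    have ht : Tendsto (ρ k) (𝓝[≠] c) (𝓝[≠] c) := by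
      refine tendsto_nhdsWithin_iff.2 ⟨?_, ?_⟩
      · have := (hρd k).continuous.tendsto c
        rw [hρc] at this
        exact this.mono_left nhdsWithin_le_nhds
      · filter_upwards [self_mem_nhdsWithin] with z hz h
        have h1 : ρ k z = c := h
        simp only [hρ, add_eq_left, mul_eq_zero, sub_eq_zero] at h1
        exact h1.elim (pow_ne_zero k I_ne_zero) hz
    exact ht.eventually hne
  obtain ⟨z, hz, hzQ⟩ := (hall.and (eventually_nhdsWithin_of_eventually_nhds
    (hQo.eventually_mem hcQ))).exists
  exact Finset.prod_ne_zero_iff.2 hz (hH0 z hzQ)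

/-- The height profile of the kinked curve. -/
def kink (s x : ℝ) : ℝ := s * max 0 (min x 1)

theorem continuous_kink (s : ℝ) : Continuous (kink s) := by
  unfold kink
  fun_prop

theorem kink_nonneg {s : ℝ} (hs : 0 ≤ s) (x : ℝ) : 0 ≤ kink s x :=
  mul_nonneg hs (le_max_left _ _)

theorem kink_le {s : ℝ} (hs : 0 ≤ s) (x : ℝ) : kink s x ≤ s :=
  mul_le_of_le_one_right hs (max_le zero_le_one (min_le_right _ _))

theorem kink_of_nonpos (s : ℝ) {x : ℝ} (hx : x ≤ 0) : kink s x = 0 := by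
  rw [kink, max_eq_left ((min_le_left _ _).trans hx), mul_zero]

theorem kink_of_one_le (s : ℝ) {x : ℝ} (hx : 1 ≤ x) : kink s x = s := by
  rw [kink, min_eq_right hx, max_eq_right zero_le_one, mul_one]

theorem eqOn_zero_of_eventually {d : ℂ → ℂ} {R : Set ℂ} (hR : IsOpen R) (hRc : Convex ℝ R)
    (hd : DifferentiableOn ℂ d R) {c : ℂ} (hc : c ∈ R) (h : ∀ᶠ z in 𝓝 c, d z = 0) {z : ℂ}
    (hz : z ∈ R) : d z = 0 :=
  (hd.analyticOnNhd hR).eqOn_zero_of_preconnected_of_eventuallyEq_zero hRc.isPreconnected hc h hz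

/-- Reflection across the line of height `t`: a pair of functions matching on a half line of that
line is related by reflection in a half-plane below. -/
theorem eq_conj_reflect {F G : ℂ → ℂ} {t : ℝ} {S : Set ℂ} (hS : IsOpen S) (hSc : Convex ℝ S)
    {B : ℝ} (hB : B ≤ t) {p : ℂ} (hp : p.im = t - 1)
    (hpS : ∀ z, |(z - p).re| ≤ 1 → z.im ≤ t → z ∈ S)
    (hF : ContinuousOn F {u | u ∈ S ∧ u.im ≤ t})
    (hF' : DifferentiableOn ℂ F ({u | u ∈ S ∧ u.im < t} ∪ {u | u.im < B}))
    (hG : ContinuousOn G {u | conj u + 2 * t * I ∈ S ∧ t ≤ u.im})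
    (hG' : DifferentiableOn ℂ G ({u | conj u + 2 * t * I ∈ S ∧ t < u.im} ∪ {u | 2 * t - B < u.im}))
    (hFG : ∀ u ∈ S, u.im = t → F u = conj (G u)) {u : ℂ} (hu : u.im < B) :
    F u = conj (G (conj u + 2 * t * I)) := by
  set τ : ℂ → ℂ := fun u => conj u + 2 * t * I with hτ
  have hτc : Continuous τ := by fun_prop
  have hττ : ∀ u, conj (τ u) + 2 * t * I = u := fun u => by
    apply Complex.ext <;> simp [hτ]
  have hτim : ∀ u, (τ u).im = 2 * t - u.im := fun u => by
    simp [hτ]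
    ring
  -- `d` is holomorphic below the line and vanishes on the part of the line in `S`; the square used
  -- below has its upper side there.
  set d : ℂ → ℂ := fun u => F u - conj (G (τ u)) with hd
  have hdiff : DifferentiableOn ℂ d ({u | u ∈ S ∧ u.im < t} ∪ {u | u.im < B}) := by
    refine hF'.sub ?_
    intro u hu
    have hD : IsOpen ({u | conj u + 2 * t * I ∈ S ∧ t < u.im} ∪ {u : ℂ | 2 * t - B < u.im}) :=
      ((hS.preimage hτc).inter (isOpen_lt continuous_const continuous_im)).union
        (isOpen_lt continuous_const continuous_im)
    have hmem : τ u ∈ {u | conj u + 2 * t * I ∈ S ∧ t < u.im} ∪ {u : ℂ | 2 * t - B < u.im} := by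
      refine hu.imp (fun h => ⟨by rw [hττ]; exact h.1, ?_⟩) fun h => ?_
      · rw [hτim]
        linarith [h.2]
      · rw [mem_ofPred_eq] at h ⊢
        rw [hτim]
        linarith
    have h1 : DifferentiableAt ℂ (fun v => G (v + 2 * t * I)) (conj u) := by
      have := hG'.differentiableAt (hD.mem_nhds hmem)
      exact DifferentiableAt.comp (conj u) (f := fun v => v + 2 * t * I) (g := G) this (by fun_prop)
    have h2 := h1.conj_conj
    rw [conj_conj] at h2
    exact h2.differentiableWithinAt
  have hcont : ContinuousOn d {u | u ∈ S ∧ u.im ≤ t} := by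
    refine hF.sub (continuous_conj.comp_continuousOn (hG.comp hτc.continuousOn fun u hu => ?_))
    refine ⟨by rw [hττ]; exact hu.1, ?_⟩
    rw [hτim]
    linarith [hu.2]
  have him : ∀ z : ℂ, (z - p).im = z.im - t + 1 := fun z => by
    rw [sub_im, hp]
    ring
  have hnear : ∀ᶠ z in 𝓝 p, d z = 0 := by
    refine eventually_eq_zero_of_square_side (hcont.mono ?_) (hdiff.mono ?_) ?_
    · rintro z ⟨h1, h2⟩
      have := (abs_le.1 h2).2
      rw [him] at this
      exact ⟨hpS z h1 (by linarith), by linarith⟩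
    · rintro z ⟨h1, h2⟩
      have := (abs_lt.1 h2).2
      rw [him] at this
      exact Or.inl ⟨hpS z h1.le (by linarith), by linarith⟩
    · intro z h1 h2
      rw [him] at h2
      have hzt : z.im = t := by linarith
      have : τ z = z := by
        apply Complex.ext <;> simp [hτ, hzt]
        ring
      simp only [hd, this]
      rw [hFG z (hpS z h1 hzt.le) hzt, sub_self]
  have hR : ∀ z ∈ {u | u ∈ S ∧ u.im < t}, d z = 0 := fun z hz =>
    eqOn_zero_of_eventually (hS.inter (isOpen_lt continuous_im continuous_const))
      (hSc.inter (convex_halfSpace_im_lt t)) (hdiff.mono subset_union_left)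
      (show p ∈ _ from ⟨hpS p (by simp) (by linarith), by rw [mem_ofPred_eq]; linarith⟩) hnear hz
  -- A point of height `B - 1`, common to the region under the half-line and the half-plane `{im <
  -- B}`, used to carry the vanishing of `d` from the former to the latter.
  set q : ℂ := p - ((t - B : ℝ) : ℂ) * I with hq
  have hqim : q.im = B - 1 := by simp [hq, hp]
  have hqre : (q - p).re = 0 := by simp [hq]
  have hqmem : q ∈ {u | u ∈ S ∧ u.im < t} :=
    ⟨hpS q (by rw [hqre]; simp) (by linarith), by linarith⟩
  have hqnear : ∀ᶠ z in 𝓝 q, d z = 0 := by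
    filter_upwards [(hS.inter (isOpen_lt continuous_im continuous_const)).mem_nhds hqmem] with z hz
    exact hR z hz
  exact sub_eq_zero.1 (eqOn_zero_of_eventually (isOpen_lt continuous_im continuous_const)
    (convex_halfSpace_im_lt B) (hdiff.mono subset_union_right)
    (show q ∈ {u : ℂ | u.im < B} by rw [mem_ofPred_eq]; linarith) hqnear hu)

/-- In the half-plane `{im < -A}` the function `F` is the reflection of `G` both in the real axis
and in the line of height `s`. The composition of the two reflections is the translation by `2 s i`.
-/
theorem eq_add_period_of_kink_match {F G : ℂ → ℂ} {A s : ℝ} (hA : 1 ≤ A) (hs : 0 < s) (hs1 : s ≤ 1)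
    (hF : ContinuousOn F {u | A < ‖u‖ ∧ u.im ≤ kink s u.re})
    (hF' : DifferentiableOn ℂ F {u | A < ‖u‖ ∧ u.im < kink s u.re})
    (hG : ContinuousOn G {u | A < ‖u‖ ∧ kink s u.re ≤ u.im})
    (hG' : DifferentiableOn ℂ G {u | A < ‖u‖ ∧ kink s u.re < u.im})
    (hFG : ∀ u : ℂ, A < ‖u‖ → u.im = kink s u.re → F u = conj (G u)) {v : ℂ} (hv : A < v.im) :
    G v = G (v + 2 * s * I) := by
  have hL : ∀ u : ℂ, u.re < -A → A < ‖u‖ ∧ kink s u.re = 0 := fun u hu =>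
    ⟨(by linarith [neg_le_abs u.re] : A < |u.re|).trans_le (abs_re_le_norm u),
      kink_of_nonpos s (by linarith)⟩
  have hRt : ∀ u : ℂ, A < u.re → A < ‖u‖ ∧ kink s u.re = s := fun u hu =>
    ⟨(hu.trans_le (le_abs_self u.re)).trans_le (abs_re_le_norm u), kink_of_one_le s (by linarith)⟩
  have hdown : ∀ u : ℂ, u.im < -A → A < ‖u‖ ∧ u.im < kink s u.re := fun u hu =>
    ⟨(by linarith [neg_le_abs u.im] : A < |u.im|).trans_le (abs_im_le_norm u),
      by linarith [kink_nonneg hs.le u.re]⟩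
  have hup : ∀ u : ℂ, A < u.im → A < ‖u‖ ∧ kink s u.re < u.im := fun u hu =>
    ⟨(hu.trans_le (le_abs_self u.im)).trans_le (abs_im_le_norm u),
      by linarith [kink_le hs.le u.re]⟩
  have hcv : (conj v).im < -A := by
    rw [conj_im]
    linarith
  have h1 := eq_conj_reflect (F := F) (G := G) (t := 0) (S := {u | u.re < -A}) (B := -A)
    (p := (-A - 2 : ℝ) - I) (isOpen_lt continuous_re continuous_const) (convex_halfSpace_re_lt _)
    (by linarith) (by simp)
    (fun z hz _ => by
      have := (abs_le.1 hz).2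
      simp at this
      rw [mem_ofPred_eq]
      linarith)
    (hF.mono fun u hu => ⟨(hL u hu.1).1, by rw [(hL u hu.1).2]; exact hu.2⟩)
    (hF'.mono fun u hu => hu.elim (fun hu => ⟨(hL u hu.1).1, by rw [(hL u hu.1).2]; exact hu.2⟩)
      (hdown u))
    (hG.mono fun u hu => by
      have := hL u (by simpa using hu.1)
      exact ⟨this.1, by rw [this.2]; exact hu.2⟩)
    (hG'.mono fun u hu => hu.elim (fun hu => by
      have := hL u (by simpa using hu.1)
      exact ⟨this.1, by rw [this.2]; exact hu.2⟩) fun hu => hup u (by simpa using hu))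
    (fun u hu h0 => hFG u (hL u hu).1 (by rw [h0, (hL u hu).2])) hcv
  have h2 := eq_conj_reflect (F := F) (G := G) (t := s) (S := {u | A < u.re}) (B := -A)
    (p := (A + 2 : ℝ) + (s - 1 : ℝ) * I) (isOpen_lt continuous_const continuous_re)
    (convex_halfSpace_re_gt _)
    (by linarith) (by simp)
    (fun z hz _ => by
      have := (abs_le.1 hz).1
      simp at this
      rw [mem_ofPred_eq]
      linarith)
    (hF.mono fun u hu => ⟨(hRt u hu.1).1, by rw [(hRt u hu.1).2]; exact hu.2⟩)
    (hF'.mono fun u hu => hu.elim (fun hu => ⟨(hRt u hu.1).1, by rw [(hRt u hu.1).2]; exact hu.2⟩)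
      (hdown u))
    (hG.mono fun u hu => by
      have := hRt u (by simpa using hu.1)
      exact ⟨this.1, by rw [this.2]; exact hu.2⟩)
    (hG'.mono fun u hu => hu.elim (fun hu => by
      have := hRt u (by simpa using hu.1)
      exact ⟨this.1, by rw [this.2]; exact hu.2⟩) fun hu => hup u (by
        rw [mem_ofPred_eq] at hu
        linarith))
    (fun u hu h0 => hFG u (hRt u hu).1 (by rw [h0, (hRt u hu).2])) hcv
  have h3 := h1.symm.trans h2
  simpa using (starRingEnd ℂ).injective h3

end MatchingProblem

/-! ### The kinked circle is an annular curve -/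

namespace MatchingProblem

open Set Metric Filter Topology Complex
open scoped ComplexConjugate

/-- The Möbius map taking the upper half-plane to the disc of radius `κ` and `∞` to `κ`. -/
noncomputable def toDisc (κ : ℝ) (u : ℂ) : ℂ := κ * (u - I) / (u + I)

/-- The inverse of `toDisc`. -/
noncomputable def toHalfPlane (κ : ℝ) (y : ℂ) : ℂ := I * (κ + y) / (κ - y)

variable {κ s ρ : ℝ}

theorem add_I_ne_zero {u : ℂ} (hu : u ≠ -I) : u + I ≠ 0 := fun h => hu (eq_neg_of_add_eq_zero_left h)

theorem ne_neg_I_of_im_nonneg {u : ℂ} (hu : 0 ≤ u.im) : u ≠ -I := by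
  rintro rfl
  simp at hu
  linarith

theorem toDisc_eq (κ : ℝ) {u : ℂ} (hu : u ≠ -I) : toDisc κ u = κ - 2 * I * κ / (u + I) := by
  have := add_I_ne_zero hu
  rw [toDisc]
  field_simp
  ring

theorem toDisc_ne (hκ : 0 < κ) {u : ℂ} (hu : u ≠ -I) : toDisc κ u ≠ κ := by
  rw [toDisc_eq κ hu, Ne, sub_eq_self, div_eq_zero_iff, not_or]
  refine ⟨?_, add_I_ne_zero hu⟩
  simp [hκ.ne']

theorem toHalfPlane_toDisc (hκ : 0 < κ) {u : ℂ} (hu : u ≠ -I) :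
    toHalfPlane κ (toDisc κ u) = u := by
  have h1 := add_I_ne_zero hu
  have hκ' : (κ : ℂ) ≠ 0 := by exact_mod_cast hκ.ne'
  rw [toHalfPlane, toDisc_eq κ hu, sub_sub_cancel]
  field_simp
  ring

theorem toHalfPlane_add_I (κ : ℝ) {y : ℂ} (hy : y ≠ κ) :
    toHalfPlane κ y + I = 2 * I * κ / (κ - y) := by
  have h1 : (κ : ℂ) - y ≠ 0 := sub_ne_zero.2 hy.symm
  rw [toHalfPlane]
  field_simp
  ring

theorem toHalfPlane_ne (hκ : 0 < κ) {y : ℂ} (hy : y ≠ κ) : toHalfPlane κ y ≠ -I := by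
  intro h
  have h1 := toHalfPlane_add_I κ hy
  rw [h, neg_add_cancel] at h1
  have h2 : (κ : ℂ) - y ≠ 0 := sub_ne_zero.2 hy.symm
  exact absurd h1.symm (div_ne_zero (by simp [hκ.ne']) h2)

theorem toDisc_toHalfPlane (hκ : 0 < κ) {y : ℂ} (hy : y ≠ κ) :
    toDisc κ (toHalfPlane κ y) = y := by
  have h1 : (κ : ℂ) - y ≠ 0 := sub_ne_zero.2 hy.symm
  have hκ' : (κ : ℂ) ≠ 0 := by exact_mod_cast hκ.ne'
  rw [toDisc_eq κ (toHalfPlane_ne hκ hy), toHalfPlane_add_I κ hy]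
  field_simp
  ring

theorem im_toHalfPlane (κ : ℝ) (y : ℂ) :
    (toHalfPlane κ y).im = (κ ^ 2 - ‖y‖ ^ 2) / ‖(κ : ℂ) - y‖ ^ 2 := by
  rw [toHalfPlane, div_im, ← normSq_eq_norm_sq, ← normSq_eq_norm_sq, normSq_apply y]
  simp
  ring

theorem norm_toDisc (hκ : 0 < κ) (u : ℂ) : ‖toDisc κ u‖ = κ * ‖u - I‖ / ‖u + I‖ := by
  rw [toDisc, norm_div, norm_mul, norm_real, Real.norm_of_nonneg hκ.le]

theorem norm_toDisc_le (hκ : 0 < κ) {u : ℂ} (hu : 0 ≤ u.im) : ‖toDisc κ u‖ ≤ κ := by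
  rw [norm_toDisc hκ, div_le_iff₀ (norm_pos_iff.2 (add_I_ne_zero (ne_neg_I_of_im_nonneg hu)))]
  gcongr
  rw [← sq_le_sq₀ (norm_nonneg _) (norm_nonneg _), ← normSq_eq_norm_sq, ← normSq_eq_norm_sq,
    normSq_apply, normSq_apply]
  simp
  nlinarith

theorem toDisc_eq_zero_iff (hκ : 0 < κ) {u : ℂ} (hu : u ≠ -I) : toDisc κ u = 0 ↔ u = I := by
  rw [toDisc, div_eq_zero_iff, or_iff_left (add_I_ne_zero hu), mul_eq_zero, sub_eq_zero,
    or_iff_right (by exact_mod_cast hκ.ne')]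

theorem continuousOn_toHalfPlane (κ : ℝ) : ContinuousOn (toHalfPlane κ) {(κ : ℂ)}ᶜ := by
  unfold toHalfPlane
  exact ContinuousOn.div (by fun_prop) (by fun_prop) fun y hy => sub_ne_zero.2 (Ne.symm hy)

theorem differentiableAt_toDisc (κ : ℝ) {u : ℂ} (hu : u ≠ -I) : DifferentiableAt ℂ (toDisc κ) u := by
  unfold toDisc
  exact DifferentiableAt.div (by fun_prop) (by fun_prop) (add_I_ne_zero hu)

/-- The region outside the kinked curve, in the coordinate of the disc. -/
def kinkRegion (κ s : ℝ) : Set ℂ := toDisc κ '' {u | kink s u.re < u.im}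

/-- A circle with a tangential jump of curvature at `κ`. -/
def kinkCurve (κ s : ℝ) : Set ℂ := insert (κ : ℂ) (toDisc κ '' {u | u.im = kink s u.re})

theorem notMem_kinkRegion (hκ : 0 < κ) (hs : 0 ≤ s) : (κ : ℂ) ∉ kinkRegion κ s := by
  rintro ⟨u, hu, h⟩
  exact toDisc_ne hκ (ne_neg_I_of_im_nonneg ((kink_nonneg hs _).trans hu.le)) h

theorem mem_kinkRegion_iff (hκ : 0 < κ) (hs : 0 ≤ s) {y : ℂ} (hy : y ≠ κ) :
    y ∈ kinkRegion κ s ↔ kink s (toHalfPlane κ y).re < (toHalfPlane κ y).im := by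
  constructor
  · rintro ⟨u, hu, rfl⟩
    rwa [toHalfPlane_toDisc hκ (ne_neg_I_of_im_nonneg ((kink_nonneg hs _).trans hu.le))]
  · exact fun h => ⟨_, h, toDisc_toHalfPlane hκ hy⟩

theorem mem_kinkCurve_iff (hκ : 0 < κ) (hs : 0 ≤ s) {y : ℂ} (hy : y ≠ κ) :
    y ∈ kinkCurve κ s ↔ (toHalfPlane κ y).im = kink s (toHalfPlane κ y).re := by
  rw [kinkCurve, mem_insert_iff, or_iff_right hy]
  constructor
  · rintro ⟨u, hu, rfl⟩
    rwa [toHalfPlane_toDisc hκ (ne_neg_I_of_im_nonneg ((kink_nonneg hs _).trans hu.ge))]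
  · exact fun h => ⟨_, h, toDisc_toHalfPlane hκ hy⟩

theorem im_toHalfPlane_one_circle (t : Circle) : (toHalfPlane 1 t).im = 0 := by
  rw [im_toHalfPlane, Circle.norm_coe]
  simp

theorem isJordanCurve_kinkCurve (hκ : 0 < κ) (hs : 0 ≤ s) (hs1 : s ≤ 1 / 2) :
    IsJordanCurve (kinkCurve κ s) := by
  set k : Circle → ℝ := fun t => kink s (toHalfPlane 1 t).re with hk
  -- The point of the kinked graph over `x = toHalfPlane 1 t`, with the pole at `t = 1` cancelled.
  -- Continuity at `1` needs only boundedness of `k`, which jumps there; `s ≤ 1 / 2` keeps the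
  -- denominator at least `1` in norm.
  set γ : Circle → ℂ := fun t => κ - 2 * κ * (1 - t) / (2 + k t * (1 - t)) with hγ
  set U : Circle → ℂ := fun t => toHalfPlane 1 t + k t * I with hU
  have hne : ∀ t : Circle, t ≠ 1 → (t : ℂ) ≠ ((1 : ℝ) : ℂ) := fun t ht h =>
    ht (Subtype.ext (by simpa using h))
  have hUim : ∀ t, (U t).im = k t := fun t => by
    simp [hU, im_toHalfPlane_one_circle]
  have hUre : ∀ t, (U t).re = (toHalfPlane 1 t).re := fun t => by simp [hU]
  have hk0 : ∀ t, 0 ≤ k t := fun t => kink_nonneg hs _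
  have hUne : ∀ t, U t ≠ -I := fun t => ne_neg_I_of_im_nonneg (by rw [hUim]; exact hk0 t)
  have hden : ∀ t, 1 ≤ ‖2 + (k t : ℂ) * (1 - t)‖ := by
    intro t
    have h1 : ‖(k t : ℂ) * (1 - t)‖ ≤ 1 / 2 * 2 := by
      rw [norm_mul, norm_real, Real.norm_of_nonneg (hk0 t)]
      refine mul_le_mul ((kink_le hs _).trans hs1) ?_ (norm_nonneg _) (by norm_num)
      refine (norm_sub_le _ _).trans ?_
      rw [Circle.norm_coe, norm_one]
      norm_num
    have h2 := norm_sub_norm_le (2 : ℂ) (-((k t : ℂ) * (1 - t)))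
    rw [sub_neg_eq_add, norm_neg, norm_ofNat] at h2
    linarith
  have hden0 : ∀ t, 2 + (k t : ℂ) * (1 - t) ≠ 0 := fun t h => by
    have := hden t
    rw [h, norm_zero] at this
    linarith
  have hγU : ∀ t, t ≠ 1 → γ t = toDisc κ (U t) := by
    intro t ht
    have h1 : (1 : ℂ) - t ≠ 0 := sub_ne_zero.2 fun h => hne t ht (by simpa using h.symm)
    have h2 : U t + I = I * (2 + k t * (1 - t)) / (1 - t) := by
      have := toHalfPlane_add_I 1 (hne t ht)
      rw [hU]
      simp only
      rw [add_right_comm, this]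
      simp only [ofReal_one]
      field_simp
    have h3 := hden0 t
    rw [toDisc_eq κ (hUne t), h2, hγ]
    simp only
    field_simp
  have hγ1 : γ 1 = κ := by simp [hγ]
  refine ⟨γ, ?_, ?_, ?_⟩
  · rw [continuous_iff_continuousAt]
    intro t
    rcases eq_or_ne t 1 with rfl | ht
    · rw [ContinuousAt, hγ1, tendsto_iff_norm_sub_tendsto_zero]
      refine squeeze_zero (g := fun t : Circle => 2 * κ * ‖1 - (t : ℂ)‖) (fun _ => norm_nonneg _)
        (fun t => ?_) ?_
      · rw [hγ]
        simp only
        rw [sub_sub_cancel_left, norm_neg, norm_div, norm_mul, norm_mul, norm_real, norm_ofNat,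
          Real.norm_of_nonneg hκ.le]
        exact div_le_self (by positivity) (hden t)
      · have : Continuous fun t : Circle => 2 * κ * ‖1 - (t : ℂ)‖ := by fun_prop
        simpa using this.tendsto 1
    · have h1 : ContinuousAt (fun t : Circle => toHalfPlane 1 t) t :=
        ((continuousOn_toHalfPlane 1).continuousAt
          (isOpen_compl_singleton.mem_nhds (hne t ht))).comp continuous_subtype_val.continuousAt
      have h2 : ContinuousAt k t :=
        (continuous_kink s).continuousAt.comp (continuous_re.continuousAt.comp h1)
      have h3 : ContinuousAt (fun t => (k t : ℂ)) t := continuous_ofReal.continuousAt.comp h2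
      have h4 : ContinuousAt (fun t : Circle => (t : ℂ)) t := continuous_subtype_val.continuousAt
      exact continuousAt_const.sub (ContinuousAt.div (by fun_prop) (by fun_prop) (hden0 t))
  · intro t t' htt
    by_cases ht : t = 1
    · by_contra hne'
      have ht' : t' ≠ 1 := fun h => hne' (ht.trans h.symm)
      rw [ht, hγ1, hγU t' ht'] at htt
      exact toDisc_ne hκ (hUne t') htt.symm
    · by_cases ht' : t' = 1
      · rw [ht', hγ1, hγU t ht] at htt
        exact absurd htt (toDisc_ne hκ (hUne t))
      · rw [hγU t ht, hγU t' ht'] at htt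
        have h1 : U t = U t' := by
          rw [← toHalfPlane_toDisc hκ (hUne t), htt, toHalfPlane_toDisc hκ (hUne t')]
        have h2 : toHalfPlane 1 t = toHalfPlane 1 t' := by
          refine Complex.ext ?_ ?_
          · rw [← hUre, h1, hUre]
          · rw [im_toHalfPlane_one_circle, im_toHalfPlane_one_circle]
        refine Subtype.ext ?_
        rw [← toDisc_toHalfPlane one_pos (hne t ht), h2, toDisc_toHalfPlane one_pos (hne t' ht')]
  · ext y
    constructor
    · rintro ⟨t, rfl⟩
      rcases eq_or_ne t 1 with rfl | ht
      · rw [hγ1]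
        exact mem_insert _ _
      · exact Or.inr ⟨U t, by rw [mem_ofPred_eq, hUim, hUre], (hγU t ht).symm⟩
    · rintro (rfl | ⟨u, hu, rfl⟩)
      · exact ⟨1, hγ1⟩
      · have hre : (u.re : ℂ) ≠ -I := ne_neg_I_of_im_nonneg (by simp)
        have hnorm : ‖toDisc 1 (u.re : ℂ)‖ = 1 := by
          have h1 := im_toHalfPlane 1 (toDisc 1 (u.re : ℂ))
          rw [toHalfPlane_toDisc one_pos hre, ofReal_im] at h1
          have h2 : ‖((1 : ℝ) : ℂ) - toDisc 1 (u.re : ℂ)‖ ^ 2 ≠ 0 :=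
            pow_ne_zero 2 (norm_ne_zero_iff.2 (sub_ne_zero.2 (toDisc_ne one_pos hre).symm))
          have h3 := (div_eq_zero_iff.1 h1.symm).resolve_right h2
          have h4 : ‖toDisc 1 (u.re : ℂ)‖ ^ 2 = 1 := by linarith
          exact (pow_eq_one_iff_of_nonneg (norm_nonneg _) two_ne_zero).1 h4
        refine ⟨⟨toDisc 1 (u.re : ℂ), mem_sphere_zero_iff_norm.2 hnorm⟩, ?_⟩
        set t : Circle := ⟨toDisc 1 (u.re : ℂ), mem_sphere_zero_iff_norm.2 hnorm⟩ with htdef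
        have htc : (t : ℂ) = toDisc 1 (u.re : ℂ) := rfl
        have ht : t ≠ 1 := fun h => toDisc_ne one_pos hre (by
          rw [← htc, h]
          simp)
        rw [hγU t ht]
        congr 1
        have h5 : toHalfPlane 1 t = u.re := by rw [htc, toHalfPlane_toDisc one_pos hre]
        rw [mem_ofPred_eq] at hu
        refine Complex.ext ?_ ?_
        · rw [hUre, h5, ofReal_re]
        · rw [hUim, hk]
          simp only [h5, ofReal_re]
          exact hu.symm

theorem isAnnularCurve_kinkCurve (hρ : 0 < ρ) (hκ : ρ < κ) (hs : 0 ≤ s) (hs1 : s ≤ 1 / 2)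
    (hsρ : s < (κ - ρ) / (κ + ρ)) :
    IsAnnularCurve (kinkRegion κ s) (kinkCurve κ s) ρ κ := by
  have hκ0 : 0 < κ := hρ.trans hκ
  have him : ∀ {u : ℂ}, kink s u.re ≤ u.im → 0 ≤ u.im := fun h => (kink_nonneg hs _).trans h
  have hkc : Continuous fun u : ℂ => kink s u.re := (continuous_kink s).comp continuous_re
  have hO : IsOpen (kinkRegion κ s) := by
    have : kinkRegion κ s = {(κ : ℂ)}ᶜ ∩ toHalfPlane κ ⁻¹' {u | kink s u.re < u.im} := by
      ext y
      constructor
      · intro hy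
        have hne : y ≠ κ := fun h => notMem_kinkRegion hκ0 hs (h ▸ hy)
        exact ⟨hne, (mem_kinkRegion_iff hκ0 hs hne).1 hy⟩
      · exact fun hy => (mem_kinkRegion_iff hκ0 hs hy.1).2 hy.2
    rw [this]
    exact (continuousOn_toHalfPlane κ).isOpen_inter_preimage isOpen_compl_singleton
      (isOpen_lt hkc continuous_im)
  have hball : closedBall 0 ρ ⊆ kinkRegion κ s := by
    intro y hy
    rw [mem_closedBall_zero_iff] at hy
    have hne : y ≠ κ := by
      rintro rfl
      rw [norm_real, Real.norm_of_nonneg hκ0.le] at hy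
      linarith
    rw [mem_kinkRegion_iff hκ0 hs hne]
    refine (kink_le hs _).trans_lt (hsρ.trans_le ?_)
    rw [im_toHalfPlane]
    have h1 : 0 < ‖(κ : ℂ) - y‖ := norm_pos_iff.2 (sub_ne_zero.2 hne.symm)
    have h2 : ‖(κ : ℂ) - y‖ ≤ κ + ρ := by
      refine (norm_sub_le _ _).trans ?_
      rw [norm_real, Real.norm_of_nonneg hκ0.le]
      linarith
    -- This is the least height of the disc of radius `ρ` in the half-plane; the graph, of height at
    -- most `s`, passes below it.
    have h3 : (κ - ρ) / (κ + ρ) = (κ ^ 2 - ρ ^ 2) / (κ + ρ) ^ 2 := by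
      have : κ + ρ ≠ 0 := by positivity
      field_simp
      ring
    have h4 : 0 ≤ κ ^ 2 - ρ ^ 2 := by nlinarith
    rw [h3]
    exact div_le_div₀ (by nlinarith [norm_nonneg y]) (by nlinarith [norm_nonneg y]) (by positivity)
      (by gcongr)
  have hpre : IsPreconnected (kinkRegion κ s) := by
    -- A vertical shear carries the upper half-plane onto the region above the graph.
    have h1 : kinkRegion κ s =
        (fun u : ℂ => toDisc κ (u + kink s u.re * I)) '' {u | 0 < u.im} := by
      ext y
      constructor
      · rintro ⟨u, hu, rfl⟩
        refine ⟨u - kink s u.re * I, ?_, ?_⟩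
        · rw [mem_ofPred_eq] at hu ⊢
          simpa using hu
        · simp
      · rintro ⟨u, hu, rfl⟩
        exact ⟨_, by rw [mem_ofPred_eq] at hu ⊢; simpa using hu, rfl⟩
    rw [h1]
    refine (convex_halfSpace_im_gt 0).isPreconnected.image _ fun u hu => ?_
    have hu' : u + kink s u.re * I ≠ -I := ne_neg_I_of_im_nonneg (by
      have := kink_nonneg hs u.re
      rw [mem_ofPred_eq] at hu
      simp
      linarith)
    have h2 : Continuous fun u : ℂ => u + kink s u.re * I := by fun_prop
    exact (ContinuousAt.comp (f := fun u : ℂ => u + kink s u.re * I)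
      (differentiableAt_toDisc κ hu').continuousAt h2.continuousAt).continuousWithinAt
  refine ⟨hO, hρ, hball, isJordanCurve_kinkCurve hκ0 hs hs1, ?_, ?_, ?_, ?_⟩
  · rintro y (⟨u, hu, rfl⟩ | rfl | ⟨u, hu, rfl⟩)
    · exact mem_closedBall_zero_iff.2 (norm_toDisc_le hκ0 (him (le_of_lt hu)))
    · simp [abs_of_pos hκ0]
    · exact mem_closedBall_zero_iff.2 (norm_toDisc_le hκ0 (him (ge_of_eq hu)))
  · have : (kinkRegion κ s ∪ kinkCurve κ s)ᶜ =
        {(κ : ℂ)}ᶜ ∩ toHalfPlane κ ⁻¹' {u | u.im < kink s u.re} := by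
      ext y
      rcases eq_or_ne y κ with rfl | hne
      · simp [kinkCurve]
      · rw [mem_compl_iff, mem_union, mem_kinkRegion_iff hκ0 hs hne, mem_kinkCurve_iff hκ0 hs hne,
          mem_inter_iff, mem_preimage, mem_ofPred_eq, not_or, not_lt]
        exact ⟨fun h => ⟨hne, lt_of_le_of_ne h.1 h.2⟩, fun h => ⟨h.2.le, h.2.ne⟩⟩
    rw [← isOpen_compl_iff, this]
    exact (continuousOn_toHalfPlane κ).isOpen_inter_preimage isOpen_compl_singleton
      (isOpen_lt continuous_im hkc)
  · rw [Set.disjoint_left]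
    intro y hy hy'
    have hne : y ≠ κ := fun h => notMem_kinkRegion hκ0 hs (h ▸ hy)
    rw [mem_kinkRegion_iff hκ0 hs hne] at hy
    rw [mem_kinkCurve_iff hκ0 hs hne] at hy'
    exact hy.ne' hy'
  · exact isPreconnected_sdiff_singleton hO hpre (hball (mem_closedBall_self hρ.le))

end MatchingProblem

/-! ### Images of kinked circles are not MP-solvable -/

namespace MatchingProblem

open Set Metric Filter Topology Complex
open scoped ComplexConjugate OnePoint

theorem mem_closure_im_lt {k : ℝ → ℝ} {u : ℂ} (hu : u.im ≤ k u.re) : u ∈ closure {v : ℂ | v.im < k v.re} := by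
  have ht : Tendsto (fun e : ℝ => u - e * I) (𝓝[>] 0) (𝓝 u) := by
    have : Continuous fun e : ℝ => u - e * I := by fun_prop
    have h := this.tendsto 0
    simp only [ofReal_zero, zero_mul, sub_zero] at h
    exact h.mono_left nhdsWithin_le_nhds
  refine mem_closure_of_tendsto ht ?_
  filter_upwards [self_mem_nhdsWithin] with e he
  have he' : 0 < e := he
  simp
  linarith

theorem mem_closure_lt_im {k : ℝ → ℝ} {u : ℂ} (hu : k u.re ≤ u.im) : u ∈ closure {v : ℂ | k v.re < v.im} := by
  have ht : Tendsto (fun e : ℝ => u + e * I) (𝓝[>] 0) (𝓝 u) := by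
    have : Continuous fun e : ℝ => u + e * I := by fun_prop
    have h := this.tendsto 0
    simp only [ofReal_zero, zero_mul, add_zero] at h
    exact h.mono_left nhdsWithin_le_nhds
  refine mem_closure_of_tendsto ht ?_
  filter_upwards [self_mem_nhdsWithin] with e he
  have he' : 0 < e := he
  simp
  linarith

theorem tendsto_toDisc_atTop (κ s : ℝ) (hs : 0 < s) {v : ℂ} (hv : 0 ≤ v.im) :
    Tendsto (fun m : ℕ => toDisc κ (v + m * (2 * s * I))) atTop (𝓝 κ) := by
  have him : ∀ m : ℕ, (v + m * (2 * s * I) + I).im = v.im + m * (2 * s) + 1 := fun m => by simp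
  have hne : ∀ m : ℕ, v + m * (2 * s * I) ≠ -I := fun m => ne_neg_I_of_im_nonneg (by
    have := him m
    rw [add_im, I_im] at this
    have h2 : 0 ≤ (m : ℝ) * (2 * s) := by positivity
    linarith)
  simp_rw [toDisc_eq κ (hne _)]
  have h1 : Tendsto (fun m : ℕ => v + m * (2 * s * I) + I) atTop (Bornology.cobounded ℂ) := by
    rw [← tendsto_norm_atTop_iff_cobounded]
    refine Filter.tendsto_atTop_mono (f := fun m : ℕ => (m : ℝ) * (2 * s)) (fun m => ?_) ?_
    · refine le_trans ?_ ((le_abs_self _).trans (abs_im_le_norm _))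
      rw [him]
      linarith
    · exact tendsto_natCast_atTop_atTop.atTop_mul_const (by positivity)
  have h2 := (tendsto_inv₀_cobounded.comp h1).const_mul (2 * I * κ : ℂ)
  have h3 := h2.const_sub (κ : ℂ)
  simpa [div_eq_mul_inv] using h3

theorem infty_mem_closure_coe_image {S : Set ℂ} (hS : ¬ Bornology.IsBounded S) :
    (∞ : OnePoint ℂ) ∈ closure ((fun z : ℂ => (z : OnePoint ℂ)) '' S) := by
  have h1 : ∃ᶠ z in Bornology.cobounded ℂ, z ∈ S := fun h => hS (Bornology.isBounded_def.2 h)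
  have h2 : Tendsto (fun z : ℂ => (z : OnePoint ℂ)) (Bornology.cobounded ℂ) (𝓝 ∞) := by
    rw [Metric.cobounded_eq_cocompact, ← coclosedCompact_eq_cocompact]
    exact OnePoint.tendsto_coe_infty
  rw [mem_closure_iff_frequently]
  exact h2.frequently (h1.mono fun z hz => ⟨z, hz, rfl⟩)

/-- Because `κ < r₀`, the coordinate `ψ` is conformal on both sides of the curve near `κ`, so the
matching condition can be pulled back to a neighbourhood of `∞` in the half-plane coordinate, where
`eq_add_period_of_kink_match` applies. -/
theorem not_isMPSolvable_image_kinkCurve {n : ℕ} {w : Fin n → ℂ} {M r₀ ρ κ s : ℝ} {ω ψ : ℂ → ℂ}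
    (h : IsExteriorCoordinate w M r₀ ω ψ) (hs : 0 < s) (hs1 : s ≤ 1 / 2) (hκ0 : 0 < κ)
    (hC : IsAnnularCurve (kinkRegion κ s) (kinkCurve κ s) ρ κ) (hr : κ < r₀) :
    ¬ IsMPSolvable (ψ '' kinkCurve κ s) := by
  rintro ⟨f, g, hf, -, hg, hgn, hfg⟩
  have hinner := h.inner_eq hC hr
  have houter := h.outer_eq hC hr
  set O := kinkRegion κ s with hOdef
  set C := kinkCurve κ s with hCdef
  have hψc : ContinuousOn ψ (ball 0 r₀ \ {0}) := h.differentiableOn.continuousOn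
  have hpo : IsOpen (ball (0 : ℂ) r₀ \ {0}) := isOpen_ball.sdiff isClosed_singleton
  have hIo : IsOpen (inner (ψ '' C)) := by
    rw [hinner]
    exact h.isOpen_compl_image hC hr
  have hcoe : ∀ z : ℂ, (z : OnePoint ℂ) ∈ outer (ψ '' C) ↔ z ∈ ψ '' (O \ {0}) := by
    intro z
    rw [houter]
    simp
  have houto : IsOpen {z : ℂ | (z : OnePoint ℂ) ∈ outer (ψ '' C)} := by
    simp_rw [hcoe]
    exact h.isOpen_image hC hr
  obtain ⟨A, hA1, hA⟩ : ∃ A : ℝ, 1 ≤ A ∧ ∀ u : ℂ, A < ‖u‖ →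
      u ≠ -I ∧ toDisc κ u ∈ ball (0 : ℂ) r₀ \ {0} := by
    have hd : 0 < r₀ - κ := by linarith
    -- The threshold beyond which `κ * (‖u‖ + 1) / (‖u‖ - 1) < r₀`; it is at least `1`, which also
    -- excludes `u = I` and `u = -I`.
    refine ⟨(r₀ + κ) / (r₀ - κ), (one_le_div hd).2 (by linarith), fun u hu => ?_⟩
    have hu1 : 1 < ‖u‖ := ((one_le_div hd).2 (by linarith)).trans_lt hu
    have hne : u ≠ -I := by
      rintro rfl
      simp at hu1
    have hne' : u ≠ I := by
      rintro rfl
      simp at hu1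
    refine ⟨hne, ?_, fun h0 => hne' ((toDisc_eq_zero_iff hκ0 hne).1 h0)⟩
    rw [mem_ball_zero_iff, norm_toDisc hκ0, div_lt_iff₀ (norm_pos_iff.2 (add_I_ne_zero hne))]
    rw [div_lt_iff₀ hd] at hu
    have h1 : ‖u - I‖ ≤ ‖u‖ + 1 := (norm_sub_le _ _).trans (by simp)
    have h2 : ‖u‖ - 1 ≤ ‖u + I‖ := by
      have := norm_sub_norm_le u (-I)
      rwa [norm_neg, norm_I, sub_neg_eq_add] at this
    have h3 := mul_le_mul_of_nonneg_left h1 hκ0.le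
    have h4 := mul_le_mul_of_nonneg_left h2 h.radius_pos.le
    linarith
  set φ : ℂ → ℂ := fun u => ψ (toDisc κ u) with hφ
  have hφd : ∀ u : ℂ, A < ‖u‖ → DifferentiableAt ℂ φ u := fun u hu =>
    DifferentiableAt.comp u (h.differentiableOn.differentiableAt (hpo.mem_nhds (hA u hu).2))
      (differentiableAt_toDisc κ (hA u hu).1)
  have hD : ∀ u : ℂ, A < ‖u‖ → toDisc κ u ≠ κ ∧ toHalfPlane κ (toDisc κ u) = u := fun u hu =>
    ⟨toDisc_ne hκ0 (hA u hu).1, toHalfPlane_toDisc hκ0 (hA u hu).1⟩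
  have hin : ∀ u : ℂ, A < ‖u‖ → u.im < kink s u.re → φ u ∈ inner (ψ '' C) := by
    intro u hu hlt
    rw [hinner, mem_compl_iff, h.mem_image_iff (hC.sdiff_subset hr), hφ,
      (h.right_inv _ (hA u hu).2).1]
    rintro ⟨-, h1 | h1, -⟩
    · rw [mem_kinkRegion_iff hκ0 hs.le (hD u hu).1, (hD u hu).2] at h1
      exact lt_asymm h1 hlt
    · rw [mem_kinkCurve_iff hκ0 hs.le (hD u hu).1, (hD u hu).2] at h1
      exact hlt.ne h1
  have hout : ∀ u : ℂ, A < ‖u‖ → kink s u.re < u.im → φ u ∈ ψ '' (O \ {0}) := by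
    intro u hu hlt
    refine ⟨_, ⟨?_, (hA u hu).2.2⟩, rfl⟩
    rw [hOdef, mem_kinkRegion_iff hκ0 hs.le (hD u hu).1, (hD u hu).2]
    exact hlt
  have hon : ∀ u : ℂ, A < ‖u‖ → u.im = kink s u.re → φ u ∈ ψ '' C := by
    intro u hu heq
    refine ⟨_, ?_, rfl⟩
    rw [hCdef, mem_kinkCurve_iff hκ0 hs.le (hD u hu).1, (hD u hu).2]
    exact heq
  have hAo : IsOpen {u : ℂ | A < ‖u‖} := isOpen_lt continuous_const continuous_norm
  have hincl : ∀ u : ℂ, A < ‖u‖ → u.im ≤ kink s u.re → φ u ∈ closure (inner (ψ '' C)) := by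
    intro u hu hle
    have hu' : u ∈ closure ({u : ℂ | A < ‖u‖} ∩ {v : ℂ | v.im < kink s v.re}) :=
      hAo.inter_closure ⟨hu, mem_closure_im_lt hle⟩
    exact (hφd u hu).continuousAt.continuousWithinAt.mem_closure hu' fun v hv => hin v hv.1 hv.2
  have hφcoe : ∀ u : ℂ, A < ‖u‖ → ContinuousAt (fun u => (φ u : OnePoint ℂ)) u := fun u hu =>
    OnePoint.continuous_coe.continuousAt.comp (hφd u hu).continuousAt
  have houtcl : ∀ u : ℂ, A < ‖u‖ → kink s u.re ≤ u.im →
      (φ u : OnePoint ℂ) ∈ closure (outer (ψ '' C)) := by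
    intro u hu hle
    have hu' : u ∈ closure ({u : ℂ | A < ‖u‖} ∩ {v : ℂ | kink s v.re < v.im}) :=
      hAo.inter_closure ⟨hu, mem_closure_lt_im hle⟩
    exact (hφcoe u hu).continuousWithinAt.mem_closure hu' fun v hv =>
      (hcoe _).2 (hout v hv.1 hv.2)
  have hper : ∀ v : ℂ, A < v.im → g (φ v) = g (φ (v + 2 * s * I)) := by
    intro v hv
    refine eq_add_period_of_kink_match (F := fun u => f (φ u)) (G := fun u => g (φ u)) hA1 hs
      (by linarith) ?_ ?_ ?_ ?_ ?_ hv
    · exact hf.1.comp (fun u hu => (hφd u hu.1).continuousAt.continuousWithinAt)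
        fun u hu => hincl u hu.1 hu.2
    · exact hf.2.comp (fun u hu => (hφd u hu.1).differentiableWithinAt) fun u hu => hin u hu.1 hu.2
    · exact hg.1.comp (fun u hu => (hφcoe u hu.1).continuousWithinAt) fun u hu => houtcl u hu.1 hu.2
    · exact hg.2.1.1.comp (f := φ) (fun u hu => (hφd u hu.1).differentiableWithinAt)
        fun u hu => (hcoe _).2 (hout u hu.1 hu.2)
    · exact fun u hu heq => hfg _ (hon u hu heq)
  have hκmem : (κ : ℂ) ∈ ball (0 : ℂ) r₀ \ {0} :=
    hC.sdiff_subset hr (hC.curve_subset_sdiff (mem_insert _ _))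
  have hup : ∀ u : ℂ, A < u.im → A < ‖u‖ ∧ kink s u.re < u.im := fun u hu =>
    ⟨(hu.trans_le (le_abs_self u.im)).trans_le (abs_im_le_norm u),
      by linarith [kink_le hs.le u.re]⟩
  -- The translates of `v` by multiples of the period tend to `∞`, that is to `κ` in the disc, and
  -- `g` is continuous at `ψ κ` from the closed outer domain.
  have hconst : ∀ v : ℂ, A < v.im → g (φ v) = g (ψ κ : ℂ) := by
    intro v hv
    have him : ∀ m : ℕ, A < (v + m * (2 * s * I)).im := fun m => by
      have h2 : 0 ≤ (m : ℝ) * (2 * s) := by positivity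
      have h3 : (v + m * (2 * s * I)).im = v.im + m * (2 * s) := by simp
      linarith
    have hm : ∀ m : ℕ, g (φ (v + m * (2 * s * I))) = g (φ v) := by
      intro m
      induction m with
      | zero => simp
      | succ m ih =>
        rw [← ih, hper _ (him m)]
        congr 3
        push_cast
        ring
    have hlim : Tendsto (fun m : ℕ => (φ (v + m * (2 * s * I)) : OnePoint ℂ)) atTop
        (𝓝 (ψ κ : ℂ)) :=
      (OnePoint.continuous_coe.tendsto _).comp
        ((hψc.continuousAt (hpo.mem_nhds hκmem)).tendsto.comp
          (tendsto_toDisc_atTop κ s hs (by linarith)))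
    have hmem : ∀ m : ℕ, (φ (v + m * (2 * s * I)) : OnePoint ℂ) ∈ closure (outer (ψ '' C)) :=
      fun m => houtcl _ (hup _ (him m)).1 (hup _ (him m)).2.le
    have hcl : ((ψ κ : ℂ) : OnePoint ℂ) ∈ closure (outer (ψ '' C)) :=
      isClosed_closure.mem_of_tendsto hlim (Eventually.of_forall hmem)
    have hglim : Tendsto (fun m : ℕ => g (φ (v + m * (2 * s * I)))) atTop (𝓝 (g (ψ κ : ℂ))) :=
      (hg.1 _ hcl).tendsto.comp (tendsto_nhdsWithin_iff.2 ⟨hlim, Eventually.of_forall hmem⟩)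
    simp_rw [hm] at hglim
    exact tendsto_nhds_unique tendsto_const_nhds hglim
  have hOψ : ∀ y ∈ O \ {0}, g (ψ y) = g (ψ κ : ℂ) := by
    have hOo : IsOpen (O \ {0}) := hC.isOpen.sdiff isClosed_singleton
    have hd : DifferentiableOn ℂ (fun y => g (ψ y)) (O \ {0}) :=
      hg.2.1.1.comp (f := ψ)
        (h.differentiableOn.mono (hC.open_sdiff_subset.trans (hC.sdiff_subset hr)))
        fun y hy => (hcoe _).2 ⟨y, hy, rfl⟩
    set v₀ : ℂ := ((A + 1 : ℝ) : ℂ) * I with hv₀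
    have hv₀A : A < v₀.im := by simp [hv₀]
    have hne₀ := (hD v₀ (hup v₀ hv₀A).1)
    have hmem₀ : toDisc κ v₀ ∈ O \ {0} := by
      refine ⟨?_, (hA v₀ (hup v₀ hv₀A).1).2.2⟩
      rw [hOdef, mem_kinkRegion_iff hκ0 hs.le hne₀.1, hne₀.2]
      exact (hup v₀ hv₀A).2
    have hev : (fun y => g (ψ y)) =ᶠ[𝓝 (toDisc κ v₀)] fun _ => g (ψ κ : ℂ) := by
      have h1 : ContinuousAt (toHalfPlane κ) (toDisc κ v₀) :=
        (continuousOn_toHalfPlane κ).continuousAt (isOpen_compl_singleton.mem_nhds hne₀.1)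
      have h2 : ∀ᶠ y in 𝓝 (toDisc κ v₀), A < (toHalfPlane κ y).im :=
        (continuous_im.continuousAt.comp h1).eventually
          (lt_mem_nhds (by simpa [hne₀.2] using hv₀A))
      filter_upwards [h2, isOpen_compl_singleton.mem_nhds hne₀.1] with y hy hyκ
      have h3 := hconst _ hy
      simp only [hφ] at h3
      rwa [toDisc_toHalfPlane hκ0 hyκ] at h3
    exact (hd.analyticOnNhd hOo).eqOn_of_preconnected_of_eventuallyEq analyticOnNhd_const
      hC.preconnected hmem₀ hev
  set E : Set (OnePoint ℂ) := (fun z : ℂ => (z : OnePoint ℂ)) '' (ψ '' (O \ {0})) with hE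
  have hEout : E ⊆ outer (ψ '' C) := by
    rw [houter]
    exact subset_insert _ _
  -- The point `∞` is a limit of finite outer points, so constancy extends to the whole closure by
  -- continuity.
  have hcl : closure (outer (ψ '' C)) ⊆ closure E := by
    refine closure_minimal ?_ isClosed_closure
    rw [houter]
    exact insert_subset (infty_mem_closure_coe_image (h.not_isBounded_image hC hr)) subset_closure
  have hgE : EqOn g (fun _ => g (ψ κ : ℂ)) E := by
    rintro _ ⟨_, ⟨y, hy, rfl⟩, rfl⟩
    exact hOψ y hy
  have hall := hgE.of_subset_closure hg.1 continuousOn_const (hEout.trans subset_closure) hcl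
  obtain ⟨x, hx, y, hy, hxy⟩ := hgn
  exact hxy ((hall hx).trans (hall hy).symm)

end MatchingProblem

/-! ### Assembling the two approximations -/

theorem mainTheorem8 (Γ : Set ℂ) (hΓ : MatchingProblem.IsJordanCurve Γ)
    (ε : ℝ) (hε : 0 < ε) :
    (∃ Γ' : Set ℂ, MatchingProblem.IsJordanCurve Γ' ∧ MatchingProblem.IsMPSolvable Γ' ∧
      Metric.hausdorffDist Γ Γ' < ε) ∧
    (∃ Γ'' : Set ℂ, MatchingProblem.IsJordanCurve Γ'' ∧ ¬ MatchingProblem.IsMPSolvable Γ'' ∧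
      Metric.hausdorffDist Γ Γ'' < ε) := by
  obtain ⟨σ, hσ, hσΓ, hσd⟩ := MatchingProblem.exists_subarc hΓ (show 0 < ε / 4 by positivity)
  have : Infinite unitInterval := (Set.Icc_infinite (zero_lt_one (α := ℝ))).to_subtype
  obtain ⟨n, w, M, r₀, ω, ψ, ρ, hρr, hρ, h, hclose⟩ :=
    MatchingProblem.exists_exteriorCoordinate_close (isCompact_range σ.continuous)
      (isConnected_range σ.continuous) (Set.infinite_range_of_injective hσ)
      (MatchingProblem.isPreconnected_compl_arc σ hσ)
      (MatchingProblem.interior_range_arc_eq_empty σ hσ) (show 0 < ε / 4 by positivity)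
  have hdist : ∀ O C r₁, MatchingProblem.IsAnnularCurve O C ρ r₁ → r₁ < r₀ →
      Metric.hausdorffDist Γ (ψ '' C) < ε := by
    intro O C r₁ hC hr
    obtain ⟨h1, h2⟩ := hclose O C r₁ hC hr
    refine lt_of_le_of_lt (Metric.hausdorffDist_le_of_mem_dist (r := ε / 2) (by positivity) ?_ ?_)
      (half_lt_self hε)
    · intro z hz
      obtain ⟨k, hk, hzk⟩ := hσd z hz
      obtain ⟨y, hy, hky⟩ := h2 k hk
      exact ⟨y, hy, by linarith [dist_triangle z k y]⟩
    · intro z hz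
      obtain ⟨k, hk, hzk⟩ := h1 z hz
      exact ⟨k, hσΓ hk, by linarith⟩
  -- One radius serves both curves: the circle of radius `κ` and its kinked version, each enclosing
  -- the disc of radius `ρ`.
  obtain ⟨κ, hκ1, hκ2⟩ := exists_between hρr
  have hκ0 : 0 < κ := hρ.trans hκ1
  constructor
  · have hC := MatchingProblem.isAnnularCurve_sphere hρ hκ1
    exact ⟨_, h.isJordanCurve_image hC hκ2, MatchingProblem.isMPSolvable_image_sphere h hκ0 hκ2,
      hdist _ _ _ hC hκ2⟩
  -- The bound `1 / 2` is for the parametrisation of the kinked curve, the other keeps the disc of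
  -- radius `ρ` inside it.
  · obtain ⟨s, hs, hs'⟩ := exists_between (show 0 < min (1 / 2) ((κ - ρ) / (κ + ρ)) from
      lt_min (by norm_num) (div_pos (by linarith) (by linarith)))
    have hs1 : s ≤ 1 / 2 := hs'.le.trans (min_le_left _ _)
    have hC := MatchingProblem.isAnnularCurve_kinkCurve hρ hκ1 hs.le hs1
      (hs'.trans_le (min_le_right _ _))
    exact ⟨_, h.isJordanCurve_image hC hκ2,
      MatchingProblem.not_isMPSolvable_image_kinkCurve h hs hs1 hκ0 hC hκ2,
      hdist _ _ _ hC hκ2⟩
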